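/- Let $K$ be a field and let $\mathcal T$ be a finite tree with vertex set $V$; let $S=K[x_v : v\in V]$ and $\mathbf x_A=\prod_{v\in A}x_v$ for $A\subseteq V$. Let $\mathcal N(\mathcal T)$ be the closed neighborhood complex of $\mathcal T$, that is, the simplicial complex whose facets are the inclusion-minimal sets among the closed neighborhoods $N_{\mathcal T}[u]$, $u\in V$. A $k$-matching of $\mathcal N(\mathcal T)$ is a set of $k$ pairwise disjoint facets; let $\nu$ be the largest $k$ for which a $k$-matching exists. Let $J=NI(\mathcal T)\subseteq S$ be the ideal generated by the monomials $\mathbf x_F$, $F$ a facet of $\mathcal N(\mathcal T)$, and let $J^{[\nu]}$ be the ideal generated by the squarefree monomials belonging to $J^\nu$. For a homogeneous ideal $I\subseteq S$ let $\beta_{i,j}(I)$ be its graded Betti numbers, and let $I_{\langle a\rangle}$ be the ideal generated by all homogeneous elements of degree $a$ in $I$. The ideal $I$ has a linear resolution if there is a $d$ with $\beta_{i,j}(I)=0$ for all $i\ge 0$ and all $j\ne i+d$; it is componentwise linear if $I_{\langle a\rangle}$ has a linear resolution for every $a$. An ideal $I$ generated by homogeneous elements of degree $d$ is linearly related if $\beta_{1,j}(I)=0$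 for all $j\neq 1+d$. Suppose that $\mathcal T$ violates Condition (C2), that is, there are an integer $n\ge 1$, a path $p_1,p_2,\dots,p_{3n-1}$ in $\mathcal T$ with $\deg p_1\ge 3$ and $\deg p_{3n-1}\ge 3$, and a $(\nu-n)$-matching $Y$ of $\mathcal N(\mathcal T)$ such that both $$\{N_{\mathcal T}[p_1],N_{\mathcal T}[p_4],\dots,N_{\mathcal T}[p_{3n-2}]\}\cup Y\quad\text{and}\quad\{N_{\mathcal T}[p_2],N_{\mathcal T}[p_5],\dots,N_{\mathcal T}[p_{3n-1}]\}\cup Y$$ are $\nu$-matchings of $\mathcal N(\mathcal T)$. Then $J^{[\nu]}$ is not componentwise linear. More precisely, there is an $a$ such that $(J^{[\nu]})_{\langle a\rangle}$ is not linearly related. -/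

import Mathlib

namespace NbhdIdeal

/-! ### Simplicial complexes, matchings and facet ideals -/

section Complexes

variable {V : Type*}

/-- The facets of a simplicial complex: its maximal faces with respect to inclusion. -/
def facets (Δ : PreAbstractSimplicialComplex V) : Set (Finset V) :=
  {F | Maximal (fun A => A ∈ Δ.faces) F}

/-- A `k`-matching of `Δ`: a set of `k` pairwise disjoint facets of `Δ`. -/
def IsKMatching (Δ : PreAbstractSimplicialComplex V) (k : ℕ) (M : Finset (Finset V)) : Prop :=
  M.card = k ∧ (∀ F ∈ M, F ∈ facets Δ) ∧ (M : Set (Finset V)).Pairwise Disjoint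

/-- The matching number of `Δ`: the largest `k` such that `Δ` has a `k`-matching
(for a complex on a finite vertex set there are only finitely many such `k`). -/
noncomputable def matchingNumber (Δ : PreAbstractSimplicialComplex V) : ℕ :=
  sSup {k | ∃ M, IsKMatching Δ k M}

/-- The squarefree monomial `x_A`, the product of the variables indexed by `A`. -/
noncomputable def sqfreeMonomial (K : Type*) [Field K] (A : Finset V) : MvPolynomial V K :=
  ∏ u ∈ A, MvPolynomial.X u

/-- The facet ideal of `Δ`. -/
noncomputable def facetIdeal (K : Type*) [Field K] (Δ : PreAbstractSimplicialComplex V) :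
    Ideal (MvPolynomial V K) :=
  Ideal.span {f | ∃ F ∈ facets Δ, f = sqfreeMonomial K F}

/-- The squarefree power `I^{[k]}`: the ideal generated by the squarefree monomials in `I ^ k`. -/
noncomputable def squarefreePower {K : Type*} [Field K] (I : Ideal (MvPolynomial V K)) (k : ℕ) :
    Ideal (MvPolynomial V K) :=
  Ideal.span {f | ∃ A : Finset V, f = sqfreeMonomial K A ∧ f ∈ I ^ k}

end Complexes

/-! ### Closed neighborhoods in graphs -/

section Graphs

variable {V : Type*} [Fintype V] [DecidableEq V]

/-- The closed neighborhood `N_G[u]`. -/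
def closedNbhd (G : SimpleGraph V) [DecidableRel G.Adj] (u : V) : Finset V :=
  insert u (G.neighborFinset u)

/-- The closed neighborhood complex of `G`: its (nonempty) faces are the (nonempty) sets contained
in a closed neighborhood that contains no other closed neighborhood properly. Hence its facets are
the inclusion-minimal closed neighborhoods. -/
def closedNbhdComplex (G : SimpleGraph V) [DecidableRel G.Adj] :
    PreAbstractSimplicialComplex V where
  faces := {F | F.Nonempty ∧ ∃ u, F ⊆ closedNbhd G u ∧ ∀ v, ¬ closedNbhd G v ⊂ closedNbhd G u}
  isRelLowerSet_faces := by
    rintro F ⟨hF, u, hu, hmin⟩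
    exact ⟨hF, fun A hA hne => ⟨hne, u, hA.trans hu, hmin⟩⟩

/-- The closed neighborhood ideal `NI(G)`: the facet ideal of the closed neighborhood complex. -/
noncomputable def closedNbhdIdeal (K : Type*) [Field K] (G : SimpleGraph V) [DecidableRel G.Adj] :
    Ideal (MvPolynomial V K) :=
  facetIdeal K (closedNbhdComplex G)

/-- Condition (C2). A path `p` on `3n - 1` vertices from `r` to `s` is a walk `w` without repeated
vertices; its vertices `p_1, p_2, …` are `w.getVert 0, w.getVert 1, …`, so that
`p_1, p_4, …, p_{3n-2}` are `w.getVert (3 * j)` and `p_2, p_5, …, p_{3n-1}` are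
`w.getVert (3 * j + 1)`, for `j < n`. -/
def ConditionC2 (T : SimpleGraph V) [DecidableRel T.Adj] : Prop :=
  ¬ ∃ (n : ℕ) (r s : V) (w : T.Walk r s) (Y : Finset (Finset V)),
      1 ≤ n ∧ w.IsPath ∧ w.support.length + 1 = 3 * n ∧
      3 ≤ T.degree r ∧ 3 ≤ T.degree s ∧
      (∃ k, k + n = matchingNumber (closedNbhdComplex T) ∧
        IsKMatching (closedNbhdComplex T) k Y) ∧
      IsKMatching (closedNbhdComplex T) (matchingNumber (closedNbhdComplex T))
        ((Finset.range n).image (fun j => closedNbhd T (w.getVert (3 * j))) ∪ Y) ∧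
      IsKMatching (closedNbhdComplex T) (matchingNumber (closedNbhdComplex T))
        ((Finset.range n).image (fun j => closedNbhd T (w.getVert (3 * j + 1))) ∪ Y)

end Graphs

/-! ### Minimal graded free resolutions and componentwise linearity -/

noncomputable section Resolutions

variable {σ K : Type*} [Field K]

open MvPolynomial

/-- A minimal graded free resolution
`… ⟶ F₂ ⟶ F₁ ⟶ F₀ ⟶ I ⟶ 0` of a homogeneous ideal `I` of the polynomial ring `S = K[x_i : i ∈ σ]`,
where `Fᵢ` is the direct sum of the modules `S(-deg i k)`, `k < rank i`.

* The map `F₀ ⟶ I` sends the basis to the family `gen`.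
* The differential `F_{i+1} ⟶ Fᵢ` is given by the matrix `diff i`; it is homogeneous of degree `0`,
  that is, each entry `(l, k)` is zero or homogeneous of degree `deg (i+1) k - deg i l`.
* Minimality: all entries of the matrices lie in the graded maximal ideal. -/
structure MinimalGradedFreeResolution (I : Ideal (MvPolynomial σ K)) where
  rank : ℕ → ℕ
  deg : (i : ℕ) → Fin (rank i) → ℕ
  gen : Fin (rank 0) → MvPolynomial σ K
  diff : (i : ℕ) → Matrix (Fin (rank i)) (Fin (rank (i + 1))) (MvPolynomial σ K)
  gen_homogeneous : ∀ k, (gen k).IsHomogeneous (deg 0 k)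
  diff_homogeneous : ∀ i l k, diff i l k = 0 ∨
    ∃ e, deg i l + e = deg (i + 1) k ∧ (diff i l k).IsHomogeneous e
  minimal : ∀ i l k, constantCoeff (diff i l k) = 0
  span_gen : Ideal.span (Set.range gen) = I
  exact_zero : Function.Exact (diff 0).mulVecLin
    (Fintype.linearCombination (MvPolynomial σ K) gen)
  exact_succ : ∀ i, Function.Exact (diff (i + 1)).mulVecLin (diff i).mulVecLin

/-- The graded Betti number `β_{i,j}`: the number of summands `S(-j)` of `Fᵢ`. (A minimal graded
free resolution is unique up to isomorphism, so it depends only on the resolved ideal.) -/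
def MinimalGradedFreeResolution.betti {I : Ideal (MvPolynomial σ K)}
    (F : MinimalGradedFreeResolution I) (i j : ℕ) : ℕ :=
  (Finset.univ.filter fun k => F.deg i k = j).card

/-- `I` has a `d`-linear resolution: `β_{i,j}(I) = 0` for all `i` and all `j ≠ i + d`. -/
def HasDLinearResolution (d : ℕ) (I : Ideal (MvPolynomial σ K)) : Prop :=
  ∃ F : MinimalGradedFreeResolution I, ∀ i j, j ≠ i + d → F.betti i j = 0

/-- `I` has a linear resolution. -/
def HasLinearResolution (I : Ideal (MvPolynomial σ K)) : Prop :=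
  ∃ d, HasDLinearResolution d I

/-- `I_⟨a⟩`: the ideal generated by all homogeneous elements of degree `a` of `I`. -/
def degreeComponentIdeal (I : Ideal (MvPolynomial σ K)) (a : ℕ) : Ideal (MvPolynomial σ K) :=
  Ideal.span {f | f ∈ I ∧ f.IsHomogeneous a}

/-- A homogeneous ideal `I` is componentwise linear if every `I_⟨a⟩` has a linear resolution. -/
def IsComponentwiseLinear (I : Ideal (MvPolynomial σ K)) : Prop :=
  ∀ a, HasLinearResolution (degreeComponentIdeal I a)

/-- An ideal `I` generated by homogeneous elements of degree `d` is linearly related if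
`β_{1,j}(I) = 0` for all `j ≠ 1 + d`. -/
def IsLinearlyRelated (d : ℕ) (I : Ideal (MvPolynomial σ K)) : Prop :=
  ∃ F : MinimalGradedFreeResolution I, ∀ j, j ≠ 1 + d → F.betti 1 j = 0

end Resolutions

end NbhdIdeal

/-! Linear syzygies link two monomials of degree `a` only through common multiples of degree `a +
1`. So it suffices to find a vertex set `W` and a degree `a` such that the degree `a` monomials of
the ideal dividing `x_W` fall into two nonempty classes, with lcms across the classes of degree at
least `a + 2`. The syzygy at `x_W` joining the classes is then not generated by linear ones
(`not_isLinearlyRelated_of_separated`, `not_isLinearlyRelated_of_two_families`).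

Number the path `p_0, …, p_{3m+1}` and shorten it until `p_3, p_6, …, p_{3m}` have degree two
(`exists_degree_lt`). Let `D` be the set of neighbors of `p_0` other than `p_1`, and `W` the union
of `D` and all that `{p_1, p_4, …} ∪ Y` covers. With the tree rooted at `p_0`, the parents of the
members of that packing meet every minimal closed neighborhood inside `W`. By counting, a maximum
packing inside `W` covers all these parents; for `p_0`, the parent of `p_1`, this puts `p_0` or
`p_1` into the packing (`zero_mem_or_one_mem`). These are the two classes.

If `P` contains `p_1` and `Q` contains `p_0`, exchanging sides of the edge `p_0 p_1`
(`exists_exchange`) gives a packing `B` containing `p_1` and covering nothing of `D`, and a packing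
`C` containing neither end, with `2ν - 1` members in total. `C` cannot be maximum, so `B` is, and
`P`, `Q` together cover at least `|covered B| + |D|` vertices. Let `Z` have the smallest cover among
such `B`, and put `a = |covered Z| + |D| - 2`. `Z` covers at most `a` vertices since `deg p_0 ≥ 3`;
shifting `Z` along the path (`exists_shift`) gains `D` but loses at least two neighbors of
`p_{3m+1}`, so the other class has a member covering at most `a` as well. -/

namespace NbhdIdeal

/-! ### Linear syzygies and separated monomials -/

section LinearRelations

open MvPolynomial

variable {σ K : Type*} [Field K]

/-- The part of a polynomial supported on a finite set of exponents. -/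
noncomputable def restrictExponents (A : Finset (σ →₀ ℕ)) (f : MvPolynomial σ K) :
    MvPolynomial σ K :=
  ∑ m ∈ A, monomial m (coeff m f)

open Classical in
lemma coeff_restrictExponents (A : Finset (σ →₀ ℕ)) (f : MvPolynomial σ K) (m : σ →₀ ℕ) :
    coeff m (restrictExponents A f) = if m ∈ A then coeff m f else 0 := by
  simp [restrictExponents, coeff_sum, coeff_monomial]

lemma degree_eq_of_coeff_ne_zero {f : MvPolynomial σ K} {n : ℕ} (hf : f.IsHomogeneous n)
    {m : σ →₀ ℕ} (hm : coeff m f ≠ 0) : m.degree = n := by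
  rw [Finsupp.degree_eq_weight_one]
  exact hf hm

lemma le_degree_of_mem_degreeComponentIdeal {I : Ideal (MvPolynomial σ K)} {a : ℕ}
    {f : MvPolynomial σ K} (hf : f ∈ degreeComponentIdeal I a) {m : σ →₀ ℕ}
    (hm : coeff m f ≠ 0) : a ≤ m.degree := by
  classical
  induction hf using Submodule.span_induction generalizing m with
  | mem x hx =>
    exact (degree_eq_of_coeff_ne_zero hx.2 hm).ge
  | zero => simp at hm
  | add x y _ _ hx hy =>
    rw [coeff_add] at hm
    by_cases h : coeff m x = 0
    · exact hy (by simpa [h] using hm)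
    · exact hx h
  | smul c x _ hx =>
    rw [smul_eq_mul, coeff_mul] at hm
    obtain ⟨⟨u, v⟩, huv, h⟩ := Finset.exists_ne_zero_of_sum_ne_zero hm
    rw [Finset.HasAntidiagonal.mem_antidiagonal] at huv
    have := hx (right_ne_zero_of_mul h)
    rw [← huv]
    rw [map_add]
    omega

lemma degreeComponentIdeal_le (I : Ideal (MvPolynomial σ K)) (a : ℕ) :
    degreeComponentIdeal I a ≤ I :=
  Ideal.span_le.2 fun _ hf => hf.1

variable {I : Ideal (MvPolynomial σ K)}

lemma MinimalGradedFreeResolution.deg_eq_of_betti (F : MinimalGradedFreeResolution I) {i d : ℕ}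
    (h : ∀ j, j ≠ d → F.betti i j = 0) (k : Fin (F.rank i)) : F.deg i k = d := by
  by_contra hk
  have := h _ hk
  simp only [betti, Finset.card_eq_zero] at this
  have hmem : k ∈ (Finset.univ.filter fun k' => F.deg i k' = F.deg i k) := by simp
  rw [this] at hmem
  simp at hmem

lemma MinimalGradedFreeResolution.gen_mem (F : MinimalGradedFreeResolution I)
    (k : Fin (F.rank 0)) : F.gen k ∈ I := by
  have h : F.gen k ∈ Ideal.span (Set.range F.gen) := Ideal.subset_span ⟨k, rfl⟩
  rwa [F.span_gen] at h

lemma MinimalGradedFreeResolution.diff_relation (F : MinimalGradedFreeResolution I)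
    (k : Fin (F.rank 1)) : ∑ l, F.diff 0 l k * F.gen l = 0 := by
  have h := (F.exact_zero ((F.diff 0).mulVecLin (Pi.single k 1))).2 ⟨_, rfl⟩
  simpa [Fintype.linearCombination_apply, Matrix.mulVec_single] using h

lemma MinimalGradedFreeResolution.exists_eq_mulVec (F : MinimalGradedFreeResolution I)
    {s : Fin (F.rank 0) → MvPolynomial σ K} (hs : ∑ l, s l * F.gen l = 0) :
    ∃ t : Fin (F.rank 1) → MvPolynomial σ K, ∀ l, s l = ∑ k, F.diff 0 l k * t k := by
  obtain ⟨t, ht⟩ := (F.exact_zero s).1 (by simpa [Fintype.linearCombination_apply] using hs)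
  exact ⟨t, fun l => by rw [← ht]; rfl⟩

lemma MinimalGradedFreeResolution.exists_eq_sum_gen (F : MinimalGradedFreeResolution I)
    {f : MvPolynomial σ K} (hf : f ∈ I) : ∃ c : Fin (F.rank 0) → MvPolynomial σ K, ∑ l, c l * F.gen l = f := by
  rw [← F.span_gen] at hf
  obtain ⟨c, hc⟩ := (Submodule.mem_span_range_iff_exists_fun _).1 hf
  exact ⟨c, by simpa using hc⟩

/-- A relation of degree `a + 1` between generators of degree at least `a` stays a relation, in
the exponents below `w`, when the generators are restricted to a set of exponents that is closed
under passing to neighbours below `w`. -/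
lemma MinimalGradedFreeResolution.coeff_restricted_relation (F : MinimalGradedFreeResolution I)
    {a : ℕ} (hI : ∀ f ∈ I, ∀ m, coeff m f ≠ 0 → a ≤ m.degree)
    (A : Finset (σ →₀ ℕ)) (w : σ →₀ ℕ)
    (hA : ∀ m ∈ A, ∀ m' ∉ A, m.degree = a → m'.degree = a →
      (∃ f ∈ I, coeff m f ≠ 0) → (∃ f ∈ I, coeff m' f ≠ 0) →
      ∀ u ≤ w, u.degree = a + 1 → m ≤ u → ¬ m' ≤ u)
    (k : Fin (F.rank 1)) (hk : F.deg 1 k = a + 1) {u : σ →₀ ℕ} (hu : u ≤ w) :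
    coeff u (∑ l, F.diff 0 l k * restrictExponents A (F.gen l)) = 0 := by
  classical
  have key : ∀ l, ∀ x y : σ →₀ ℕ, x + y = u → coeff x (F.diff 0 l k) ≠ 0 →
      coeff y (F.gen l) ≠ 0 → u.degree = a + 1 ∧ y.degree = a := by
    intro l x y hxy hx hy
    rcases F.diff_homogeneous 0 l k with h0 | ⟨e, he, hhom⟩
    · simp [h0] at hx
    have h1 : x.degree = e := degree_eq_of_coeff_ne_zero hhom hx
    have h2 : y.degree = F.deg 0 l := 
      degree_eq_of_coeff_ne_zero (F.gen_homogeneous l) hy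
    have h3 : a ≤ y.degree := hI _ (F.gen_mem l) _ hy
    -- By minimality `x` has degree at least 1; as `y` has degree at least `a` and the total is `a +
    -- 1`, both degrees are forced.
    have h4 : x.degree ≠ 0 := by
      intro h
      rw [Finsupp.degree_eq_zero_iff] at h
      subst h
      exact hx (F.minimal 0 l k)
    rw [← hxy, map_add]
    change F.deg 0 l + e = F.deg 1 k at he
    omega
  -- If one such exponent lies in `A`, all contributing ones do, and restriction does not change
  -- this coefficient; otherwise every term vanishes.
  by_cases hex : ∃ y ∈ A, y ≤ u ∧ y.degree = a ∧ u.degree = a + 1 ∧ ∃ l, coeff y (F.gen l) ≠ 0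
  · obtain ⟨y₀, hy₀A, hy₀u, hy₀a, hua, l₀, hl₀⟩ := hex
    refine Eq.trans ?_ ((congrArg (coeff u) (F.diff_relation k)).trans (coeff_zero u))
    rw [coeff_sum, coeff_sum]
    refine Finset.sum_congr rfl fun l _ => ?_
    rw [coeff_mul, coeff_mul]
    refine Finset.sum_congr rfl fun ⟨x, y⟩ hxy => ?_
    rw [Finset.HasAntidiagonal.mem_antidiagonal] at hxy
    rw [coeff_restrictExponents]
    by_cases hx : coeff x (F.diff 0 l k) = 0
    · simp [hx]
    by_cases hy : coeff y (F.gen l) = 0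
    · simp [hy]
    rw [if_pos]
    by_contra hyA
    exact hA y₀ hy₀A y hyA hy₀a (key l x y hxy hx hy).2 ⟨_, F.gen_mem l₀, hl₀⟩
      ⟨_, F.gen_mem l, hy⟩ u hu hua hy₀u (hxy ▸ le_add_self)
  · rw [coeff_sum]
    refine Finset.sum_eq_zero fun l _ => ?_
    rw [coeff_mul]
    refine Finset.sum_eq_zero fun ⟨x, y⟩ hxy => ?_
    rw [Finset.HasAntidiagonal.mem_antidiagonal] at hxy
    rw [coeff_restrictExponents]
    by_contra hne
    have hx := left_ne_zero_of_mul hne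
    have hy := right_ne_zero_of_mul hne
    simp only [ne_eq, ite_eq_right_iff, Classical.not_imp] at hy
    obtain ⟨h1, h2⟩ := key l x y hxy hx hy.2
    exact hex ⟨y, hy.1, hxy ▸ le_add_self, h2, h1, l, hy.2⟩

/-- An ideal whose degree `a` monomials below `w` fall into two parts that are not joined by
monomials of degree `a + 1` below `w` is not linearly related. -/
theorem not_isLinearlyRelated_of_separated {a : ℕ}
    (hI : ∀ f ∈ I, ∀ m, coeff m f ≠ 0 → a ≤ m.degree)
    (A : Finset (σ →₀ ℕ)) (w : σ →₀ ℕ)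
    (hA : ∀ m ∈ A, ∀ m' ∉ A, m.degree = a → m'.degree = a →
      (∃ f ∈ I, coeff m f ≠ 0) → (∃ f ∈ I, coeff m' f ≠ 0) →
      ∀ u ≤ w, u.degree = a + 1 → m ≤ u → ¬ m' ≤ u)
    {c c' : σ →₀ ℕ} (hcA : c ∈ A) (hcA' : c' ∉ A) (hcw : c ≤ w) (hcw' : c' ≤ w)
    (hca : c.degree = a) (hca' : c'.degree = a)
    (hcI : monomial c (1 : K) ∈ I) (hcI' : monomial c' (1 : K) ∈ I) :
    ¬ IsLinearlyRelated a I := by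
  classical
  rintro ⟨F, hF⟩
  obtain ⟨g, hg⟩ := F.exists_eq_sum_gen hcI
  obtain ⟨g', hg'⟩ := F.exists_eq_sum_gen hcI'
  -- The syzygy between the two monomials in multidegree `w`, lifted to the generators of `F`.
  set s : Fin (F.rank 0) → MvPolynomial σ K :=
    fun l => monomial (w - c) 1 * g l - monomial (w - c') 1 * g' l with hs
  have hrel : ∑ l, s l * F.gen l = 0 := by
    simp only [hs, sub_mul, Finset.sum_sub_distrib, mul_assoc, ← Finset.mul_sum, hg, hg',
      monomial_mul, tsub_add_cancel_of_le hcw, tsub_add_cancel_of_le hcw', sub_self]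
  obtain ⟨t, ht⟩ := F.exists_eq_mulVec hrel
  -- Linear syzygies vanish below `w` on the restricted generators, hence so does `s`; a direct
  -- evaluation by `hval` gives 1 instead.
  have hzero : coeff w (∑ l, s l * restrictExponents A (F.gen l)) = 0 := by
    have : ∑ l, s l * restrictExponents A (F.gen l) =
        ∑ k, t k * ∑ l, F.diff 0 l k * restrictExponents A (F.gen l) := by
      simp only [ht, Finset.sum_mul, Finset.mul_sum]
      rw [Finset.sum_comm]
      refine Finset.sum_congr rfl fun k _ => Finset.sum_congr rfl fun l _ => by ring
    rw [this, coeff_sum]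
    refine Finset.sum_eq_zero fun k _ => ?_
    rw [coeff_mul]
    refine Finset.sum_eq_zero fun ⟨x, y⟩ hxy => ?_
    rw [Finset.HasAntidiagonal.mem_antidiagonal] at hxy
    rw [F.coeff_restricted_relation hI A w hA k
      (by rw [F.deg_eq_of_betti hF k, add_comm]) (hxy ▸ le_add_self), mul_zero]
  have hval : ∀ (h : Fin (F.rank 0) → MvPolynomial σ K) (b : σ →₀ ℕ), b ≤ w → b.degree = a →
      coeff w (∑ l, monomial (w - b) 1 * h l * restrictExponents A (F.gen l)) =
        if b ∈ A then coeff b (∑ l, h l * F.gen l) else 0 := by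
    intro h b hbw hba
    simp only [mul_assoc]
    rw [← Finset.mul_sum]
    conv_lhs => rw [← tsub_add_cancel_of_le hbw, tsub_add_cancel_of_le hbw]
    have h1 := coeff_monomial_mul b (w - b) (1 : K)
      (∑ l, h l * restrictExponents A (F.gen l))
    rw [tsub_add_cancel_of_le hbw] at h1
    rw [h1, one_mul, coeff_sum, coeff_sum]
    -- Exponents occurring in the ideal have degree at least `a`, so none lies strictly below `b`.
    have hterm : ∀ l, ∀ x y : σ →₀ ℕ, x + y = b → coeff y (F.gen l) ≠ 0 → y = b := by
      intro l x y hxy hy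
      have h2 := hI _ (F.gen_mem l) y hy
      have h3 : x.degree = 0 := by
        have := congrArg Finsupp.degree hxy
        rw [map_add] at this
        omega
      rw [Finsupp.degree_eq_zero_iff] at h3
      simpa [h3] using hxy
    by_cases hbA : b ∈ A
    · rw [if_pos hbA]
      refine Finset.sum_congr rfl fun l _ => ?_
      rw [coeff_mul, coeff_mul]
      refine Finset.sum_congr rfl fun ⟨x, y⟩ hxy => ?_
      rw [Finset.HasAntidiagonal.mem_antidiagonal] at hxy
      rw [coeff_restrictExponents]
      by_cases hy : coeff y (F.gen l) = 0
      · simp [hy]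
      · rw [if_pos (hterm l x y hxy hy ▸ hbA)]
    · rw [if_neg hbA]
      refine Finset.sum_eq_zero fun l _ => ?_
      rw [coeff_mul]
      refine Finset.sum_eq_zero fun ⟨x, y⟩ hxy => ?_
      rw [Finset.HasAntidiagonal.mem_antidiagonal] at hxy
      rw [coeff_restrictExponents]
      split_ifs with hyA
      · by_cases hy : coeff y (F.gen l) = 0
        · simp [hy]
        · exact absurd (hterm l x y hxy hy ▸ hyA) hbA
      · simp
  simp only [hs, sub_mul, Finset.sum_sub_distrib, coeff_sub] at hzero
  rw [hval g c hcw hca, hval g' c' hcw' hca', if_pos hcA, if_neg hcA', hg] at hzero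
  simp at hzero

/-- If `I_⟨a⟩` contains a monomial of degree `a` and has a linear resolution, then it is linearly
related. -/
lemma isLinearlyRelated_of_hasLinearResolution {a : ℕ}
    (hI : ∀ f ∈ I, ∀ m, coeff m f ≠ 0 → a ≤ m.degree) {c : σ →₀ ℕ} (hc : c.degree = a)
    (hcI : monomial c (1 : K) ∈ I) (h : HasLinearResolution I) : IsLinearlyRelated a I := by
  classical
  obtain ⟨d, F, hF⟩ := h
  refine ⟨F, fun j hj => hF 1 j ?_⟩
  -- Some generator has an exponent below `c`, hence of degree exactly `a`; this forces `d = a`.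
  obtain ⟨g, hg⟩ := F.exists_eq_sum_gen hcI
  have h1 : coeff c (∑ l, g l * F.gen l) ≠ 0 := by rw [hg]; simp
  rw [coeff_sum] at h1
  obtain ⟨l, -, hl⟩ := Finset.exists_ne_zero_of_sum_ne_zero h1
  rw [coeff_mul] at hl
  obtain ⟨⟨x, y⟩, hxy, hne⟩ := Finset.exists_ne_zero_of_sum_ne_zero hl
  rw [Finset.HasAntidiagonal.mem_antidiagonal] at hxy
  have hy := right_ne_zero_of_mul hne
  have h2 := hI _ (F.gen_mem l) y hy
  have h3 : y.degree = F.deg 0 l := 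
    degree_eq_of_coeff_ne_zero (F.gen_homogeneous l) hy
  have h4 : F.deg 0 l = 0 + d := F.deg_eq_of_betti (fun j hj => hF 0 j hj) l
  have h5 := congrArg Finsupp.degree hxy
  rw [map_add] at h5
  dsimp only at h5
  omega

end LinearRelations

/-! ### Squarefree monomials and their exponents -/

section SquarefreeExponents

open MvPolynomial

variable {V : Type*}

/-- The exponent of the squarefree monomial `x_A`. -/
noncomputable def sqfreeExponent (A : Finset V) : V →₀ ℕ :=
  ∑ u ∈ A, Finsupp.single u 1

lemma degree_sqfreeExponent (A : Finset V) : (sqfreeExponent A).degree = A.card := by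
  simp [sqfreeExponent, map_sum]

lemma sqfreeMonomial_eq (K : Type*) [Field K] (A : Finset V) :
    sqfreeMonomial K A = monomial (sqfreeExponent A) 1 := by
  simp [sqfreeMonomial, sqfreeExponent, monomial_sum_one, X]

variable [DecidableEq V]

lemma sqfreeExponent_apply (A : Finset V) (v : V) :
    sqfreeExponent A v = if v ∈ A then 1 else 0 := by
  simp [sqfreeExponent, Finsupp.finsetSum_apply, Finsupp.single_apply]

lemma sqfreeExponent_le_iff {A B : Finset V} : sqfreeExponent A ≤ sqfreeExponent B ↔ A ⊆ B := by
  constructor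
  · intro h v hv
    have := h v
    rw [sqfreeExponent_apply, sqfreeExponent_apply, if_pos hv] at this
    by_contra hvB
    simp [hvB] at this
  · intro h v
    rw [sqfreeExponent_apply, sqfreeExponent_apply]
    split_ifs with h1 h2
    · exact le_rfl
    · exact absurd (h h1) h2
    · exact Nat.zero_le _
    · exact le_rfl

lemma sqfreeExponent_injective : Function.Injective (sqfreeExponent (V := V)) := by
  intro A B h
  exact Finset.Subset.antisymm (sqfreeExponent_le_iff.1 h.le) (sqfreeExponent_le_iff.1 h.ge)

lemma eq_sqfreeExponent_of_le {m : V →₀ ℕ} {A : Finset V} (h : m ≤ sqfreeExponent A) :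
    ∃ C ⊆ A, m = sqfreeExponent C := by
  refine ⟨m.support, ?_, ?_⟩
  · intro v hv
    have := h v
    rw [sqfreeExponent_apply] at this
    by_contra hvA
    rw [if_neg hvA] at this
    exact (Finsupp.mem_support_iff.1 hv) (by omega)
  · ext v
    have := h v
    rw [sqfreeExponent_apply] at this ⊢
    split_ifs with h1
    · rw [Finsupp.mem_support_iff] at h1
      split_ifs at this <;> omega
    · simpa using h1

lemma exists_disjoint_of_add_eq_sqfreeExponent {x y : V →₀ ℕ} {C : Finset V}
    (h : x + y = sqfreeExponent C) :
    ∃ A B, x = sqfreeExponent A ∧ y = sqfreeExponent B ∧ A ⊆ C ∧ B ⊆ C ∧ Disjoint A B := by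
  obtain ⟨A, hA, rfl⟩ := eq_sqfreeExponent_of_le (h ▸ le_self_add : x ≤ _)
  obtain ⟨B, hB, rfl⟩ := eq_sqfreeExponent_of_le (h ▸ le_add_self : y ≤ _)
  refine ⟨A, B, rfl, rfl, hA, hB, Finset.disjoint_left.2 fun v hvA hvB => ?_⟩
  have := DFunLike.congr_fun h v
  rw [Finsupp.add_apply, sqfreeExponent_apply, sqfreeExponent_apply, sqfreeExponent_apply] at this
  simp [hvA, hvB, hA hvA] at this

variable {K : Type*} [Field K]

lemma exists_subset_of_mem_span_sqfreeMonomial {s : Set (Finset V)} {f : MvPolynomial V K}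
    (hf : f ∈ Ideal.span {g | ∃ A ∈ s, g = sqfreeMonomial K A}) {C : Finset V}
    (hC : coeff (sqfreeExponent C) f ≠ 0) : ∃ A ∈ s, A ⊆ C := by
  have hs : {g | ∃ A ∈ s, g = sqfreeMonomial K A} =
      (fun m => monomial m (1 : K)) '' (sqfreeExponent '' s) := by
    ext g
    simp [sqfreeMonomial_eq, eq_comm]
  rw [hs, mem_ideal_span_monomial_image] at hf
  obtain ⟨_, ⟨A, hA, rfl⟩, hle⟩ := hf _ (mem_support_iff.2 hC)
  exact ⟨A, hA, sqfreeExponent_le_iff.1 hle⟩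

lemma monomial_mem_degreeComponentIdeal {I : Ideal (MvPolynomial V K)} {A C : Finset V}
    (hA : sqfreeMonomial K A ∈ I) (hAC : A ⊆ C) :
    monomial (sqfreeExponent C) (1 : K) ∈ degreeComponentIdeal I C.card := by
  refine Ideal.subset_span ⟨?_, ?_⟩
  · have h := I.mul_mem_left (monomial (sqfreeExponent C - sqfreeExponent A) 1) hA
    rwa [sqfreeMonomial_eq, monomial_mul,
      tsub_add_cancel_of_le (sqfreeExponent_le_iff.2 hAC), one_mul] at h
  · exact isHomogeneous_monomial _ (degree_sqfreeExponent C)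

end SquarefreeExponents

/-! ### Matchings as sets of centers, and squarefree powers -/

section Packings

open MvPolynomial

variable {V : Type*} [Fintype V] [DecidableEq V] (T : SimpleGraph V) [DecidableRel T.Adj]

/-- A packing: a set of vertices whose closed neighborhoods are inclusion-minimal and pairwise
disjoint. -/
structure IsPacking (P : Finset V) : Prop where
  minimal : ∀ u ∈ P, ∀ v, ¬ closedNbhd T v ⊂ closedNbhd T u
  disjoint : (P : Set V).PairwiseDisjoint (closedNbhd T)

/-- The union of the closed neighborhoods of the vertices in `P`. -/
def covered (P : Finset V) : Finset V := P.biUnion (closedNbhd T)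

variable {T}

lemma mem_closedNbhd {u v : V} : v ∈ closedNbhd T u ↔ v = u ∨ T.Adj u v := by
  simp [closedNbhd]

lemma self_mem_closedNbhd (u : V) : u ∈ closedNbhd T u := mem_closedNbhd.2 (Or.inl rfl)

lemma mem_closedNbhd_comm {u v : V} : v ∈ closedNbhd T u ↔ u ∈ closedNbhd T v := by
  rw [mem_closedNbhd, mem_closedNbhd, eq_comm, T.adj_comm]

lemma mem_covered {P : Finset V} {v : V} : v ∈ covered T P ↔ ∃ u ∈ P, v ∈ closedNbhd T u := by
  simp [covered]

lemma IsPacking.eq_of_mem {P : Finset V} (hP : IsPacking T P) {u v w : V} (hu : u ∈ P)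
    (hv : v ∈ P) (hwu : w ∈ closedNbhd T u) (hwv : w ∈ closedNbhd T v) : u = v := by
  by_contra h
  exact Finset.disjoint_left.1 (hP.disjoint hu hv h) hwu hwv

lemma isPacking_of_forall {P : Finset V}
    (hmin : ∀ u ∈ P, ∀ v, ¬ closedNbhd T v ⊂ closedNbhd T u)
    (h : ∀ u ∈ P, ∀ v ∈ P, ∀ w, w ∈ closedNbhd T u → w ∈ closedNbhd T v → u = v) :
    IsPacking T P :=
  ⟨hmin, fun u hu v hv huv => Finset.disjoint_left.2 fun w hwu hwv => huv (h u hu v hv w hwu hwv)⟩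

/-- The inclusion-minimal closed neighborhoods form an antichain, so none of them sits in a larger
face. -/
lemma mem_facets_closedNbhdComplex {F : Finset V} :
    F ∈ facets (closedNbhdComplex T) ↔
      ∃ u, (∀ v, ¬ closedNbhd T v ⊂ closedNbhd T u) ∧ F = closedNbhd T u := by
  constructor
  · rintro ⟨⟨-, u, hu, hmin⟩, hmax⟩
    exact ⟨u, hmin, Finset.Subset.antisymm hu
      (hmax ⟨⟨u, self_mem_closedNbhd u⟩, u, Finset.Subset.refl _, hmin⟩ hu)⟩
  · rintro ⟨u, hmin, rfl⟩
    refine ⟨⟨⟨u, self_mem_closedNbhd u⟩, u, Finset.Subset.refl _, hmin⟩, ?_⟩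
    rintro A ⟨-, v, hv, hvmin⟩ hA
    by_contra h
    exact hvmin u ⟨hA.trans hv, fun h' => h (hv.trans h')⟩

lemma IsPacking.injOn {P : Finset V} (hP : IsPacking T P) :
    Set.InjOn (closedNbhd T) (P : Set V) := by
  intro u hu v hv huv
  exact hP.eq_of_mem hu hv (self_mem_closedNbhd u)
    (by simpa only [huv] using self_mem_closedNbhd (T := T) u)

lemma IsPacking.isKMatching {P : Finset V} (hP : IsPacking T P) :
    IsKMatching (closedNbhdComplex T) P.card (P.image (closedNbhd T)) := by
  refine ⟨Finset.card_image_of_injOn hP.injOn, ?_, ?_⟩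
  · intro F hF
    obtain ⟨u, hu, rfl⟩ := Finset.mem_image.1 hF
    exact mem_facets_closedNbhdComplex.2 ⟨u, hP.minimal u hu, rfl⟩
  · intro F hF G hG hFG
    obtain ⟨u, hu, rfl⟩ := Finset.mem_image.1 hF
    obtain ⟨v, hv, rfl⟩ := Finset.mem_image.1 hG
    exact hP.disjoint hu hv fun h => hFG (by rw [h])

lemma IsPacking.card_le {P : Finset V} (hP : IsPacking T P) :
    P.card ≤ matchingNumber (closedNbhdComplex T) := by
  -- Boundedness has to be supplied: in `ℕ` the supremum of an unbounded set is 0 by default.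
  refine le_csSup ⟨Fintype.card (Finset V), ?_⟩ ⟨_, hP.isKMatching⟩
  rintro k ⟨M, hM, -⟩
  exact hM ▸ Finset.card_le_univ M

lemma IsPacking.subset {P Q : Finset V} (hQ : IsPacking T Q) (h : P ⊆ Q) : IsPacking T P :=
  ⟨fun u hu => hQ.minimal u (h hu), hQ.disjoint.subset (by exact_mod_cast h)⟩

variable {K : Type*} [Field K]

/-- A squarefree exponent in a product splits into squarefree exponents with disjoint supports.
Induction packs the support of the first factor, and the second contributes one more, disjoint,
facet. -/
lemma exists_isPacking_of_mem_pow (k : ℕ) {f : MvPolynomial V K}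
    (hf : f ∈ closedNbhdIdeal K T ^ k) {C : Finset V} (hC : coeff (sqfreeExponent C) f ≠ 0) :
    ∃ P, IsPacking T P ∧ P.card = k ∧ covered T P ⊆ C := by
  induction k generalizing f C with
  | zero => exact ⟨∅, ⟨by simp, by simp⟩, rfl, by simp [covered]⟩
  | succ k ih =>
    rw [pow_succ] at hf
    induction hf using Submodule.mul_induction_on' generalizing C with
    | add x _ y _ hx hy =>
      rw [coeff_add] at hC
      by_cases h : coeff (sqfreeExponent C) x = 0
      · exact hy (by simpa [h] using hC)
      · exact hx h
    | mem_mul_mem g hg h hh =>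
      rw [coeff_mul] at hC
      obtain ⟨⟨x, y⟩, hxy, hne⟩ := Finset.exists_ne_zero_of_sum_ne_zero hC
      rw [Finset.HasAntidiagonal.mem_antidiagonal] at hxy
      obtain ⟨A, B, rfl, rfl, hA, hB, hAB⟩ := exists_disjoint_of_add_eq_sqfreeExponent hxy
      obtain ⟨P, hP, hPk, hPA⟩ := ih hg (left_ne_zero_of_mul hne)
      obtain ⟨F, hF, hFB⟩ := exists_subset_of_mem_span_sqfreeMonomial hh (right_ne_zero_of_mul hne)
      obtain ⟨u, humin, rfl⟩ := mem_facets_closedNbhdComplex.1 hF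
      have hdisj : ∀ v ∈ P, Disjoint (closedNbhd T v) (closedNbhd T u) := fun v hv =>
        hAB.mono ((Finset.subset_biUnion_of_mem (closedNbhd T) hv).trans hPA) hFB
      have hu : u ∉ P := fun h =>
        Finset.disjoint_left.1 (hdisj u h) (self_mem_closedNbhd u) (self_mem_closedNbhd u)
      refine ⟨insert u P, ⟨?_, ?_⟩, by rw [Finset.card_insert_of_notMem hu, hPk], ?_⟩
      · intro v hv
        rcases Finset.mem_insert.1 hv with rfl | hv
        · exact humin
        · exact hP.minimal v hv
      · rw [Finset.coe_insert, Set.pairwiseDisjoint_insert_of_notMem (by exact_mod_cast hu)]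
        exact ⟨hP.disjoint, fun v hv => (hdisj v hv).symm⟩
      · rw [covered, Finset.biUnion_insert]
        exact Finset.union_subset (hFB.trans hB) (hPA.trans hA)

lemma exists_isPacking_of_mem_squarefreePower {k : ℕ} {f : MvPolynomial V K}
    (hf : f ∈ squarefreePower (closedNbhdIdeal K T) k) {C : Finset V}
    (hC : coeff (sqfreeExponent C) f ≠ 0) :
    ∃ P, IsPacking T P ∧ P.card = k ∧ covered T P ⊆ C := by
  have hf' : f ∈ Ideal.span {g | ∃ A ∈ {A | sqfreeMonomial K A ∈ closedNbhdIdeal K T ^ k},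
      g = sqfreeMonomial K A} := by
    refine Ideal.span_mono ?_ hf
    rintro g ⟨A, rfl, hA⟩
    exact ⟨A, hA, rfl⟩
  obtain ⟨A, hA, hAC⟩ := exists_subset_of_mem_span_sqfreeMonomial hf' hC
  obtain ⟨P, hP, hk, hPA⟩ := exists_isPacking_of_mem_pow k hA (C := A)
    (by simp [sqfreeMonomial_eq])
  exact ⟨P, hP, hk, hPA.trans hAC⟩

lemma IsPacking.sqfreeMonomial_mem {P : Finset V} (hP : IsPacking T P) :
    sqfreeMonomial K (covered T P) ∈ squarefreePower (closedNbhdIdeal K T) P.card := by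
  refine Ideal.subset_span ⟨_, rfl, ?_⟩
  rw [sqfreeMonomial, covered, Finset.prod_biUnion hP.disjoint, ← Finset.prod_const]
  refine Ideal.prod_mem_prod fun u hu => Ideal.subset_span ?_
  exact ⟨_, mem_facets_closedNbhdComplex.2 ⟨u, hP.minimal u hu, rfl⟩, rfl⟩

/-- If the maximum packings inside `W` fall into two families such that the union of any two
members of different families has at least `a + 2` elements, and each family has a member of size
at most `a`, then the degree `a` component of `NI(T)^{[ν]}` is not linearly related. -/
theorem not_isLinearlyRelated_of_two_families {ν a : ℕ} {W : Finset V}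
    {S S' : Finset V → Prop}
    (hcases : ∀ P, IsPacking T P → P.card = ν → covered T P ⊆ W → S P ∨ S' P)
    (hsep : ∀ P Q, IsPacking T P → P.card = ν → covered T P ⊆ W →
      IsPacking T Q → Q.card = ν → covered T Q ⊆ W → S P → S' Q →
      a + 2 ≤ (covered T P ∪ covered T Q).card)
    (hS : ∃ P, IsPacking T P ∧ P.card = ν ∧ covered T P ⊆ W ∧ S P ∧ (covered T P).card ≤ a)
    (hS' : ∃ P, IsPacking T P ∧ P.card = ν ∧ covered T P ⊆ W ∧ S' P ∧ (covered T P).card ≤ a) :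
    ¬ IsComponentwiseLinear (squarefreePower (closedNbhdIdeal K T) ν) ∧
      ¬ IsLinearlyRelated a
        (degreeComponentIdeal (squarefreePower (closedNbhdIdeal K T) ν) a) := by
  classical
  obtain ⟨P, hP, hPk, hPW, hPS, hPa⟩ := hS
  obtain ⟨Q, hQ, hQk, hQW, hQS, hQa⟩ := hS'
  -- Room to enlarge both covers inside `W` to exactly `a` elements.
  have haW : a ≤ W.card := by
    have h1 := hsep P Q hP hPk hPW hQ hQk hQW hPS hQS
    have h2 := Finset.card_le_card (Finset.union_subset hPW hQW)
    omega
  obtain ⟨C, hPC, hCW, hCa⟩ := Finset.exists_subsuperset_card_eq hPW hPa haW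
  obtain ⟨C', hQC, hCW', hCa'⟩ := Finset.exists_subsuperset_card_eq hQW hQa haW
  have hdeg : ∀ f ∈ degreeComponentIdeal (squarefreePower (closedNbhdIdeal K T) ν) a,
      ∀ m, coeff m f ≠ 0 → a ≤ m.degree :=
    fun f hf m hm => le_degree_of_mem_degreeComponentIdeal hf hm
  have hmem : ∀ R D : Finset V, IsPacking T R → R.card = ν → covered T R ⊆ D → D.card = a →
      monomial (sqfreeExponent D) (1 : K) ∈
        degreeComponentIdeal (squarefreePower (closedNbhdIdeal K T) ν) a := by
    rintro R D hR rfl hRD rfl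
    exact monomial_mem_degreeComponentIdeal hR.sqfreeMonomial_mem hRD
  have hnot : ¬ IsLinearlyRelated a
      (degreeComponentIdeal (squarefreePower (closedNbhdIdeal K T) ν) a) := by
    -- The first class consists of the subsets of `W` containing the cover of a packing from `S`; a
    -- monomial outside it can only come from `S'`.
    refine not_isLinearlyRelated_of_separated hdeg
      (((W.powerset).filter fun D => ∃ R, IsPacking T R ∧ R.card = ν ∧ covered T R ⊆ D ∧
        S R).image sqfreeExponent) (sqfreeExponent W) ?_
      (c := sqfreeExponent C) (c' := sqfreeExponent C') ?_ ?_
      (sqfreeExponent_le_iff.2 hCW) (sqfreeExponent_le_iff.2 hCW')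
      (by rw [degree_sqfreeExponent, hCa]) (by rw [degree_sqfreeExponent, hCa'])
      (hmem P C hP hPk hPC hCa) (hmem Q C' hQ hQk hQC hCa')
    · rintro m hm m' hm' - - - ⟨f, hf, hfm⟩ u huw hua hmu hmu'
      obtain ⟨D, hD, rfl⟩ := Finset.mem_image.1 hm
      obtain ⟨hDW, R, hR, hRk, hRD, hRS⟩ := Finset.mem_filter.1 hD
      rw [Finset.mem_powerset] at hDW
      obtain ⟨U, hUW, rfl⟩ := eq_sqfreeExponent_of_le huw
      obtain ⟨D', hDU', rfl⟩ := eq_sqfreeExponent_of_le hmu'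
      obtain ⟨R', hR', hRk', hRD'⟩ :=
        exists_isPacking_of_mem_squarefreePower (degreeComponentIdeal_le _ _ hf) hfm
      have hRW' := hRD'.trans (hDU'.trans hUW)
      rcases hcases R' hR' hRk' hRW' with h | h
      · exact hm' (Finset.mem_image.2 ⟨D', Finset.mem_filter.2
          ⟨Finset.mem_powerset.2 (hDU'.trans hUW), R', hR', hRk', hRD', h⟩, rfl⟩)
      · have h1 := hsep R R' hR hRk (hRD.trans hDW) hR' hRk' hRW' hRS h
        have h2 := Finset.card_le_card (Finset.union_subset
          (hRD.trans (sqfreeExponent_le_iff.1 hmu)) (hRD'.trans hDU'))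
        rw [degree_sqfreeExponent] at hua
        omega
    · exact Finset.mem_image_of_mem _ (Finset.mem_filter.2
        ⟨Finset.mem_powerset.2 hCW, P, hP, hPk, hPC, hPS⟩)
    · intro h
      obtain ⟨D, hD, hDC⟩ := Finset.mem_image.1 h
      obtain rfl := sqfreeExponent_injective hDC
      obtain ⟨hDW, R, hR, hRk, hRD, hRS⟩ := Finset.mem_filter.1 hD
      have h1 := hsep R Q hR hRk (hRD.trans hCW') hQ hQk hQW hRS hQS
      have h2 := Finset.card_le_card (Finset.union_subset hRD hQC)
      omega
  refine ⟨fun h => hnot ?_, hnot⟩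
  exact isLinearlyRelated_of_hasLinearResolution hdeg
    (by rw [degree_sqfreeExponent, hCa]) (hmem P C hP hPk hPC hCa) (h a)

end Packings

/-! ### Rooted trees: parents, distances, cuts -/

section Trees

variable {V : Type*} {T : SimpleGraph V}

/-- Both vertices are penultimate on a geodesic from `r` to `v`, and paths in a tree are unique. -/
lemma eq_of_adj_of_dist_eq_add_one (hT : T.IsTree) {r u u' v : V} (h : T.Adj u v)
    (h' : T.Adj u' v) (hd : T.dist r v = T.dist r u + 1) (hd' : T.dist r v = T.dist r u' + 1) :
    u = u' := by
  obtain ⟨p, hp⟩ := hT.connected.exists_walk_length_eq_dist r u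
  obtain ⟨p', hp'⟩ := hT.connected.exists_walk_length_eq_dist r u'
  have h1 : (p.concat h).IsPath := SimpleGraph.Walk.isPath_of_length_eq_dist _ (by simp [hp, hd])
  have h2 : (p'.concat h').IsPath :=
    SimpleGraph.Walk.isPath_of_length_eq_dist _ (by simp [hp', hd'])
  have h3 := (hT.existsUnique_path r v).unique h1 h2
  simpa using congrArg SimpleGraph.Walk.penultimate h3

lemma exists_adj_dist_eq_add_one (hT : T.IsTree) {r v : V} (hv : v ≠ r) :
    ∃ u, T.Adj u v ∧ T.dist r v = T.dist r u + 1 := by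
  obtain ⟨p, hp⟩ := hT.connected.exists_walk_length_eq_dist r v
  have hnil : ¬ p.Nil := fun h => hv h.eq.symm
  have hadj := p.adj_penultimate hnil
  refine ⟨p.penultimate, hadj, ?_⟩
  have h1 : T.dist r p.penultimate ≤ p.length - 1 := by
    simpa using SimpleGraph.dist_le p.dropLast
  have h2 : 0 < p.length := SimpleGraph.Walk.not_nil_iff_lt_length.1 hnil
  rcases hT.dist_eq_dist_add_one_of_adj r hadj with h | h <;> omega

open Classical in
/-- The neighbor of `v` on the path from `v` to `r` (and `r` itself for `v = r`), in a tree. -/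
noncomputable def parent (T : SimpleGraph V) (r v : V) : V :=
  if h : ∃ u, T.Adj u v ∧ T.dist r v = T.dist r u + 1 then h.choose else v

lemma parent_self (r : V) : parent T r r = r := by
  rw [parent, dif_neg]
  rintro ⟨u, -, hu⟩
  simp at hu

lemma parent_adj (hT : T.IsTree) {r v : V} (hv : v ≠ r) : T.Adj (parent T r v) v := by
  have h := exists_adj_dist_eq_add_one hT hv
  rw [parent, dif_pos h]
  exact h.choose_spec.1

lemma dist_parent (hT : T.IsTree) {r v : V} (hv : v ≠ r) :
    T.dist r v = T.dist r (parent T r v) + 1 := by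
  have h := exists_adj_dist_eq_add_one hT hv
  rw [parent, dif_pos h]
  exact h.choose_spec.2

lemma parent_eq_or_parent_eq (hT : T.IsTree) (r : V) {u v : V} (h : T.Adj u v) :
    parent T r u = v ∨ parent T r v = u := by
  rcases hT.dist_eq_dist_add_one_of_adj r h with hd | hd
  · have hu : u ≠ r := by rintro rfl; simp at hd
    exact Or.inl (eq_of_adj_of_dist_eq_add_one hT (parent_adj hT hu) h.symm
      (dist_parent hT hu) hd)
  · have hv : v ≠ r := by rintro rfl; simp at hd
    exact Or.inr (eq_of_adj_of_dist_eq_add_one hT (parent_adj hT hv) h (dist_parent hT hv) hd)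

/-- Ends of an edge have different distances from `u`, whereas `v` and `w` are both at distance 1.
-/
lemma not_adj_of_adj_adj (hT : T.IsTree) {u v w : V} (h : T.Adj u v) (h' : T.Adj u w) :
    ¬ T.Adj v w := by
  intro hvw
  rcases hT.dist_eq_dist_add_one_of_adj u hvw with hd | hd <;>
    rw [SimpleGraph.dist_eq_one_iff_adj.2 h, SimpleGraph.dist_eq_one_iff_adj.2 h'] at hd <;>
    omega

/-- Cutting a tree at an edge `uv`: the only edge leaving the part of `v` is `vu`. -/
lemma exists_cut (hT : T.IsTree) {u v : V} (h : T.Adj u v) :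
    ∃ R : Set V, v ∈ R ∧ u ∉ R ∧ ∀ x y, x ∈ R → y ∉ R → T.Adj x y → x = v ∧ y = u := by
  refine ⟨{x | (T.deleteEdges {s(u, v)}).Reachable v x}, SimpleGraph.Reachable.refl _, ?_, ?_⟩
  · intro hu
    exact (SimpleGraph.isBridge_iff.1
      (SimpleGraph.isAcyclic_iff_forall_adj_isBridge.1 hT.isAcyclic h)) hu.symm
  · have hu : ¬ (T.deleteEdges {s(u, v)}).Reachable v u := fun hu =>
      (SimpleGraph.isBridge_iff.1
        (SimpleGraph.isAcyclic_iff_forall_adj_isBridge.1 hT.isAcyclic h)) hu.symm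
    intro x y hx hy hxy
    by_cases he : s(x, y) = s(u, v)
    · rcases Sym2.eq_iff.1 he with ⟨rfl, rfl⟩ | ⟨rfl, rfl⟩
      · exact absurd hx hu
      · exact ⟨rfl, rfl⟩
    · refine absurd (SimpleGraph.Reachable.trans hx (SimpleGraph.Adj.reachable ?_)) hy
      rw [SimpleGraph.deleteEdges_adj]
      exact ⟨hxy, he⟩

end Trees

/-! ### Parents of a packing as a transversal -/

section Transversal

variable {V : Type*} [Fintype V] [DecidableEq V] {T : SimpleGraph V} [DecidableRel T.Adj]

/-- Root the tree at `r`. If all neighborhoods in question are made of vertices covered by the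
packing `B` and neighbors of `r`, then the parents of the vertices in `B` form a transversal. -/
lemma exists_parent_mem_closedNbhd (hT : T.IsTree) {r s : V} {B : Finset V}
    (hB : IsPacking T B) (hrB : r ∉ B) (hs : s ∈ B) (hrs : T.Adj r s)
    (hrmin : ∀ v, ¬ closedNbhd T v ⊂ closedNbhd T r)
    (hDB : ∀ x ∈ covered T B, T.Adj r x → x = s) {q : V}
    (hqmin : ∀ v, ¬ closedNbhd T v ⊂ closedNbhd T q)
    (hqW : ∀ x ∈ closedNbhd T q, x ∈ covered T B ∨ T.Adj r x) :
    ∃ b ∈ B, parent T r b ∈ closedNbhd T q ∧ (T.Adj r q → q ≠ s → parent T r b ≠ r) := by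
  have hpr := parent_self (T := T) r
  have hchild : ∀ {x}, T.Adj r x → parent T r x = r := by
    intro x hx
    rcases parent_eq_or_parent_eq hT r hx with h | h
    · rw [hpr] at h
      exact absurd (h ▸ hx) (T.irrefl)
    · exact h
  by_cases hqr : q = r
  · subst hqr
    exact ⟨s, hs, by rw [hchild hrs]; exact self_mem_closedNbhd _, fun h => absurd h T.irrefl⟩
  by_cases hqB : q ∈ covered T B
  · obtain ⟨b, hb, hqb⟩ := mem_covered.1 hqB
    have hbr : b ≠ r := fun h => hrB (h ▸ hb)
    suffices h : ∃ b ∈ B, parent T r b ∈ closedNbhd T q by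
      obtain ⟨b, hb, h⟩ := h
      exact ⟨b, hb, h, fun h1 h2 => absurd (hDB q hqB h1) h2⟩
    by_cases hpb : parent T r b ∈ closedNbhd T q
    · exact ⟨b, hb, hpb⟩
    have hqb' : T.Adj b q := by
      rcases mem_closedNbhd.1 hqb with rfl | h
      · exact absurd (mem_closedNbhd.2 (Or.inr (parent_adj hT hbr).symm)) hpb
      · exact h
    -- Since `parent b` is not in `N[q]`, the inclusion `N[q] ⊆ N[b]` would be proper, against
    -- minimality of `N[b]`. The resulting `c` is a grandchild of `b`, and it turns out to be
    -- covered by one of its own children, whose parent `c` is in `N[q]`.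
    obtain ⟨c, hcq, hcb⟩ : ∃ c ∈ closedNbhd T q, c ∉ closedNbhd T b := by
      by_contra! h
      refine hB.minimal b hb q ⟨h, fun h' => hpb (h' ?_)⟩
      exact mem_closedNbhd.2 (Or.inr (parent_adj hT hbr).symm)
    have hcb' : c ≠ b := fun h => hcb (h ▸ self_mem_closedNbhd _)
    have hqc : T.Adj q c := by
      rcases mem_closedNbhd.1 hcq with rfl | h
      · exact absurd hqb hcb
      · exact h
    have hpq : parent T r q = b := by
      rcases parent_eq_or_parent_eq hT r hqb' with h | h
      · exact absurd (by rw [h]; exact self_mem_closedNbhd q) hpb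
      · exact h
    have hpc : parent T r c = q := by
      rcases parent_eq_or_parent_eq hT r hqc with h | h
      · exact absurd (h.symm.trans hpq) hcb'
      · exact h
    rcases hqW c hcq with hcB | hrc
    · obtain ⟨b', hb', hcb''⟩ := mem_covered.1 hcB
      have hb'c : T.Adj b' c := by
        rcases mem_closedNbhd.1 hcb'' with rfl | h
        · exact absurd (hB.eq_of_mem hb' hb (mem_closedNbhd_comm.1 hcq) hqb) hcb'
        · exact h
      rcases parent_eq_or_parent_eq hT r hb'c with h | h
      · exact ⟨b', hb', by rwa [h]⟩
      · obtain rfl : b' = q := h.symm.trans hpc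
        obtain rfl := hB.eq_of_mem hb' hb (self_mem_closedNbhd _) hqb
        exact absurd hqb' T.irrefl
    · exact absurd (hpc.symm.trans (hchild hrc)) hqr
  · have hrq : T.Adj r q := (hqW q (self_mem_closedNbhd q)).resolve_left hqB
    have hsq : s ∉ closedNbhd T q := by
      intro h
      rcases mem_closedNbhd.1 h with rfl | h
      · exact hqB (mem_covered.2 ⟨s, hs, self_mem_closedNbhd s⟩)
      · exact not_adj_of_adj_adj hT hrq hrs h
    -- Now minimality of `N[r]` is used, with `s` witnessing properness. Again `c` is covered by one
    -- of its children, and its distinctness from `r` gives the last clause.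
    obtain ⟨c, hcq, hcr⟩ : ∃ c ∈ closedNbhd T q, c ∉ closedNbhd T r := by
      by_contra! h
      exact hrmin q ⟨h, fun h' => hsq (h' (mem_closedNbhd.2 (Or.inr hrs)))⟩
    have hcr' : c ≠ r := fun h => hcr (h ▸ self_mem_closedNbhd _)
    have hqc : T.Adj q c := by
      rcases mem_closedNbhd.1 hcq with rfl | h
      · exact absurd (mem_closedNbhd.2 (Or.inr hrq)) hcr
      · exact h
    have hpc : parent T r c = q := by
      rcases parent_eq_or_parent_eq hT r hqc with h | h
      · exact absurd (h.symm.trans (hchild hrq)) hcr'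
      · exact h
    have hcB : c ∈ covered T B :=
      (hqW c hcq).resolve_right fun h => hcr (mem_closedNbhd.2 (Or.inr h))
    obtain ⟨b', hb', hcb'⟩ := mem_covered.1 hcB
    have hb'c : T.Adj b' c := by
      rcases mem_closedNbhd.1 hcb' with rfl | h
      · exact absurd (mem_covered.2 ⟨c, hb', mem_closedNbhd_comm.1 hcq⟩) hqB
      · exact h
    rcases parent_eq_or_parent_eq hT r hb'c with h | h
    · exact ⟨b', hb', by rwa [h], fun _ _ => by rwa [h]⟩
    · obtain rfl : b' = q := h.symm.trans hpc
      exact absurd (mem_covered.2 ⟨b', hb', self_mem_closedNbhd _⟩) hqB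

/-- Choosing for each `z` in `Z` a member of `B` whose parent lies in `N[z]` is injective, as these
neighborhoods are disjoint; equal cardinality makes it surjective. -/
lemma exists_mem_parent_mem_closedNbhd (hT : T.IsTree) {r s : V} {B : Finset V}
    (hB : IsPacking T B) (hrB : r ∉ B) (hs : s ∈ B) (hrs : T.Adj r s)
    (hrmin : ∀ v, ¬ closedNbhd T v ⊂ closedNbhd T r)
    (hDB : ∀ x ∈ covered T B, T.Adj r x → x = s) {Z : Finset V} (hZ : IsPacking T Z)
    (hZB : Z.card = B.card) (hZW : ∀ x ∈ covered T Z, x ∈ covered T B ∨ T.Adj r x)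
    {b : V} (hb : b ∈ B) :
    ∃ z ∈ Z, parent T r b ∈ closedNbhd T z ∧ (T.Adj r z → z ≠ s → parent T r b ≠ r) := by
  have h : ∀ z ∈ Z, ∃ b ∈ B, parent T r b ∈ closedNbhd T z ∧
      (T.Adj r z → z ≠ s → parent T r b ≠ r) := fun z hz =>
    exists_parent_mem_closedNbhd hT hB hrB hs hrs hrmin hDB (hZ.minimal z hz)
      fun x hx => hZW x (mem_covered.2 ⟨z, hz, hx⟩)
  choose! g hgB hg using h
  have hinj : Set.InjOn g (Z : Set V) := fun z hz z' hz' hzz' =>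
    hZ.eq_of_mem hz hz' (hg z hz).1 (hzz' ▸ (hg z' hz').1)
  have himage : Z.image g = B := Finset.eq_of_subset_of_card_le
    (Finset.image_subset_iff.2 hgB) (by rw [Finset.card_image_of_injOn hinj, hZB])
  rw [← himage] at hb
  obtain ⟨z, hz, rfl⟩ := Finset.mem_image.1 hb
  exact ⟨z, hz, hg z hz⟩

end Transversal

/-! ### Exchanging two packings across an edge -/

section Exchange

variable {V : Type*} [Fintype V] [DecidableEq V] {T : SimpleGraph V} [DecidableRel T.Adj]

open Classical in
/-- Two packings exchange their parts on one side of the edge `uv` of a tree. -/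
lemma exists_exchange (hT : T.IsTree) {u v : V} (huv : T.Adj u v) {P Q : Finset V}
    (hP : IsPacking T P) (hQ : IsPacking T Q) (hvP : v ∈ P) (huQ : u ∈ Q) :
    ∃ A B : Finset V, IsPacking T A ∧ IsPacking T B ∧ A.card + B.card + 1 = P.card + Q.card ∧
      A ⊆ P ∪ Q ∧ B ⊆ P ∪ Q ∧ v ∈ A ∧ (∀ x ∈ covered T A, T.Adj u x → x = v) ∧
      u ∉ B ∧ v ∉ B := by
  obtain ⟨R, hvR, huR, hcut⟩ := exists_cut hT huv
  have hmem : ∀ {x y}, x ∈ R → y ∈ closedNbhd T x → y ∈ R ∨ (x = v ∧ y = u) := by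
    intro x y hx hy
    by_cases hyR : y ∈ R
    · exact Or.inl hyR
    · rcases mem_closedNbhd.1 hy with rfl | h
      · exact Or.inl hx
      · exact Or.inr (hcut x y hx hyR h)
  have hnotMem : ∀ {x y}, x ∉ R → y ∈ closedNbhd T x → y ∉ R ∨ (x = u ∧ y = v) := by
    intro x y hx hy
    by_cases hyR : y ∈ R
    · rcases mem_closedNbhd.1 hy with rfl | h
      · exact Or.inl hx
      · exact Or.inr (hcut y x hyR hx h.symm).symm
    · exact Or.inl hyR
  have hne : u ≠ v := huv.ne
  have huP : u ∉ P := fun h => hne (hP.eq_of_mem h hvP (self_mem_closedNbhd u)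
    (mem_closedNbhd.2 (Or.inr huv.symm)))
  have hvQ : v ∉ Q := fun h => hne (hQ.eq_of_mem huQ h (self_mem_closedNbhd u)
    (mem_closedNbhd.2 (Or.inr huv.symm)))
  have hA : ∀ x ∈ P, x ∈ R → ∀ y ∈ Q, y ∉ R → y ≠ u → ∀ w, w ∈ closedNbhd T x →
      w ∉ closedNbhd T y := by
    intro x _ hxR y hy hyR hyu w hwx hwy
    rcases hnotMem hyR hwy with h | ⟨h, -⟩
    · rcases hmem hxR hwx with h' | ⟨-, rfl⟩
      · exact h h'
      · exact hyu (hQ.eq_of_mem hy huQ hwy (self_mem_closedNbhd _))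
    · exact hyu h
  have hB : ∀ x ∈ P, x ∉ R → ∀ y ∈ Q, y ∈ R → ∀ w, w ∈ closedNbhd T x →
      w ∉ closedNbhd T y := by
    intro x hx hxR y hy hyR w hwx hwy
    rcases hnotMem hxR hwx with h | ⟨rfl, -⟩
    · rcases hmem hyR hwy with h' | ⟨rfl, -⟩
      · exact h h'
      · exact hvQ hy
    · exact huP hx
  -- The vertex `u` has to be dropped, since `N[u]` meets `N[v]`; it is the only loss and accounts
  -- for the `+ 1` in the count.
  refine ⟨P.filter (· ∈ R) ∪ (Q.filter (· ∉ R)).erase u, P.filter (· ∉ R) ∪ Q.filter (· ∈ R),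
    ?_, ?_, ?_, ?_, ?_, ?_, ?_, ?_, ?_⟩
  · refine isPacking_of_forall ?_ ?_
    · intro x hx
      simp only [Finset.mem_union, Finset.mem_filter, Finset.mem_erase] at hx
      rcases hx with hx | hx
      · exact hP.minimal x hx.1
      · exact hQ.minimal x hx.2.1
    · intro x hx y hy w hwx hwy
      simp only [Finset.mem_union, Finset.mem_filter, Finset.mem_erase] at hx hy
      rcases hx with hx | hx <;> rcases hy with hy | hy
      · exact hP.eq_of_mem hx.1 hy.1 hwx hwy
      · exact absurd hwy (hA x hx.1 hx.2 y hy.2.1 hy.2.2 hy.1 w hwx)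
      · exact absurd hwx (hA y hy.1 hy.2 x hx.2.1 hx.2.2 hx.1 w hwy)
      · exact hQ.eq_of_mem hx.2.1 hy.2.1 hwx hwy
  · refine isPacking_of_forall ?_ ?_
    · intro x hx
      simp only [Finset.mem_union, Finset.mem_filter] at hx
      rcases hx with hx | hx
      · exact hP.minimal x hx.1
      · exact hQ.minimal x hx.1
    · intro x hx y hy w hwx hwy
      simp only [Finset.mem_union, Finset.mem_filter] at hx hy
      rcases hx with hx | hx <;> rcases hy with hy | hy
      · exact hP.eq_of_mem hx.1 hy.1 hwx hwy
      · exact absurd hwy (hB x hx.1 hx.2 y hy.1 hy.2 w hwx)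
      · exact absurd hwx (hB y hy.1 hy.2 x hx.1 hx.2 w hwy)
      · exact hQ.eq_of_mem hx.1 hy.1 hwx hwy
  · rw [Finset.card_union_of_disjoint, Finset.card_union_of_disjoint]
    · have h1 := Finset.card_filter_add_card_filter_not (s := P) (· ∈ R)
      have h2 := Finset.card_filter_add_card_filter_not (s := Q) (· ∈ R)
      have h3 := Finset.card_erase_add_one
        (show u ∈ Q.filter (· ∉ R) from Finset.mem_filter.2 ⟨huQ, huR⟩)
      omega
    · exact Finset.disjoint_left.2 fun x hx hx' =>
        (Finset.mem_filter.1 hx).2 (Finset.mem_filter.1 hx').2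
    · exact Finset.disjoint_left.2 fun x hx hx' =>
        (Finset.mem_filter.1 (Finset.mem_of_mem_erase hx')).2 (Finset.mem_filter.1 hx).2
  · exact Finset.union_subset_union (Finset.filter_subset _ _)
      ((Finset.erase_subset _ _).trans (Finset.filter_subset _ _))
  · exact Finset.union_subset_union (Finset.filter_subset _ _) (Finset.filter_subset _ _)
  · exact Finset.mem_union_left _ (Finset.mem_filter.2 ⟨hvP, hvR⟩)
  · intro x hx hux
    obtain ⟨y, hy, hxy⟩ := mem_covered.1 hx
    simp only [Finset.mem_union, Finset.mem_filter, Finset.mem_erase] at hy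
    rcases hy with hy | hy
    · rcases hmem hy.2 hxy with h | ⟨-, rfl⟩
      · exact (hcut x u h huR hux.symm).1
      · exact absurd hux T.irrefl
    · exact absurd (hQ.eq_of_mem hy.2.1 huQ hxy (mem_closedNbhd.2 (Or.inr hux))) hy.1
  · simp [huP, huR]
  · simp [hvQ, hvR]

end Exchange

/-! ### Every third vertex of a path -/

section Strands

variable {V : Type*} [DecidableEq V]

/-- The vertices `p_i, p_{i+3}, …, p_{i+3m}`. -/
def strand (m : ℕ) (p : ℕ → V) (i : ℕ) : Finset V :=
  (Finset.range (m + 1)).image fun j => p (3 * j + i)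

lemma mem_strand {m : ℕ} {p : ℕ → V} {i : ℕ} {v : V} :
    v ∈ strand m p i ↔ ∃ j ≤ m, p (3 * j + i) = v := by
  simp [strand]

lemma start_mem_strand {m : ℕ} {p : ℕ → V} : p 0 ∈ strand m p 0 :=
  mem_strand.2 ⟨0, Nat.zero_le _, rfl⟩

lemma one_mem_strand {m : ℕ} {p : ℕ → V} : p 1 ∈ strand m p 1 :=
  mem_strand.2 ⟨0, Nat.zero_le _, rfl⟩

end Strands

/-! ### Alternating paths and the two classes of maximum packings -/

section AlternatingPaths

variable {V : Type*} [Fintype V] [DecidableEq V] {T : SimpleGraph V} [DecidableRel T.Adj]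

/-- A path `p_0, …, p_{3m+1}` with ends of degree at least three and a set `Y` such that both
`{p_0, p_3, …} ∪ Y` and `{p_1, p_4, …} ∪ Y` are maximum packings. -/
structure AlternatingPath (T : SimpleGraph V) [DecidableRel T.Adj] (m : ℕ) (p : ℕ → V)
    (Y : Finset V) : Prop where
  adj : ∀ i ≤ 3 * m, T.Adj (p i) (p (i + 1))
  inj : ∀ i ≤ 3 * m + 1, ∀ j ≤ 3 * m + 1, p i = p j → i = j
  degree_start : 3 ≤ T.degree (p 0)
  degree_end : 3 ≤ T.degree (p (3 * m + 1))
  card_add : Y.card + (m + 1) = matchingNumber (closedNbhdComplex T)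
  first : IsPacking T (strand m p 0 ∪ Y)
  second : IsPacking T (strand m p 1 ∪ Y)
  disjoint_first : Disjoint (strand m p 0) Y
  disjoint_second : Disjoint (strand m p 1) Y

lemma dist_le_of_mem_closedNbhd (hT : T.IsTree) (r : V) {u v : V} (h : v ∈ closedNbhd T u) :
    T.dist r v ≤ T.dist r u + 1 ∧ T.dist r u ≤ T.dist r v + 1 := by
  rcases mem_closedNbhd.1 h with rfl | h
  · omega
  · rcases hT.dist_eq_dist_add_one_of_adj r h with h | h <;> omega

namespace AlternatingPath

variable {m : ℕ} {p : ℕ → V} {Y : Finset V}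

lemma card_strand (h : AlternatingPath T m p Y) {i : ℕ} (hi : i ≤ 1) :
    (strand m p i).card = m + 1 := by
  rw [strand, Finset.card_image_of_injOn, Finset.card_range]
  intro j hj k hk hjk
  simp only [Finset.coe_range, Set.mem_Iio] at hj hk
  have := h.inj _ (by omega) _ (by omega) hjk
  omega

lemma parent_succ (h : AlternatingPath T m p Y) (hT : T.IsTree) {i : ℕ} (hi : i ≤ 3 * m) :
    parent T (p 0) (p (i + 1)) = p i := by
  induction i with
  | zero =>
    rcases parent_eq_or_parent_eq hT (p 0) (h.adj 0 hi) with h1 | h1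
    · rw [parent_self] at h1
      exact absurd h1 (h.adj 0 hi).ne
    · exact h1
  | succ i ih =>
    rcases parent_eq_or_parent_eq hT (p 0) (h.adj (i + 1) hi) with h1 | h1
    · rw [ih (by omega)] at h1
      have := h.inj _ (by omega) _ (by omega) h1
      omega
    · exact h1

lemma dist_eq (h : AlternatingPath T m p Y) (hT : T.IsTree) {i : ℕ} (hi : i ≤ 3 * m + 1) :
    T.dist (p 0) (p i) = i := by
  induction i with
  | zero => simp
  | succ i ih =>
    have hne : p (i + 1) ≠ p 0 := fun h1 => by
      have := h.inj _ hi _ (by omega) h1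
      omega
    rw [dist_parent hT hne, h.parent_succ hT (by omega), ih (by omega)]

/-- The vertices `p_0, p_3, …, p_{3k-3}` move into `Y`. The first packing stays inside the old one;
in the second, the indices of the moved vertices differ by at least 4 from those of the remaining
strand, so the neighborhoods cannot meet. -/
lemma suffix (hT : T.IsTree) {k l : ℕ} (h : AlternatingPath T (k + l) p Y)
    (hk : 3 ≤ T.degree (p (3 * k))) :
    AlternatingPath T l (fun i => p (3 * k + i))
      (Y ∪ (Finset.range k).image fun j => p (3 * j)) := by
  have hstrand : ∀ i, strand l (fun i => p (3 * k + i)) i ⊆ strand (k + l) p i := by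
    intro i x hx
    obtain ⟨j, hj, rfl⟩ := mem_strand.1 hx
    exact mem_strand.2 ⟨k + j, by omega, congrArg p (by ring)⟩
  have hpre : ∀ {x}, x ∈ (Finset.range k).image (fun j => p (3 * j)) →
      ∃ j < k, p (3 * j) = x := by
    intro x hx
    obtain ⟨j, hj, rfl⟩ := Finset.mem_image.1 hx
    exact ⟨j, Finset.mem_range.1 hj, rfl⟩
  have hpre' : (Finset.range k).image (fun j => p (3 * j)) ⊆ strand (k + l) p 0 := by
    intro x hx
    obtain ⟨j, hj, rfl⟩ := hpre hx
    exact mem_strand.2 ⟨j, by omega, rfl⟩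
  have hfirst : ∀ {x}, x ∈ Y ∪ (Finset.range k).image (fun j => p (3 * j)) →
      x ∈ strand (k + l) p 0 ∪ Y := fun hx =>
    (Finset.mem_union.1 hx).elim (Finset.mem_union_right _)
      fun hx => Finset.mem_union_left _ (hpre' hx)
  have hdisj : ∀ i ≤ 1, Disjoint (strand l (fun i => p (3 * k + i)) i)
      ((Finset.range k).image fun j => p (3 * j)) := by
    intro i hi
    refine Finset.disjoint_left.2 fun x hx hx' => ?_
    obtain ⟨j, hj, rfl⟩ := mem_strand.1 hx
    obtain ⟨j', hj', hjj⟩ := hpre hx'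
    have := h.inj _ (by omega) _ (by omega) hjj
    omega
  have hsep : ∀ x ∈ strand l (fun i => p (3 * k + i)) 1,
      ∀ y ∈ (Finset.range k).image (fun j => p (3 * j)), ∀ w, w ∈ closedNbhd T x →
      w ∉ closedNbhd T y := by
    intro x hx y hy w hwx hwy
    obtain ⟨j, hj, rfl⟩ := mem_strand.1 hx
    obtain ⟨j', hj', rfl⟩ := hpre hy
    have h1 := dist_le_of_mem_closedNbhd hT (p 0) hwx
    have h2 := dist_le_of_mem_closedNbhd hT (p 0) hwy
    simp only [h.dist_eq hT (show 3 * k + (3 * j + 1) ≤ 3 * (k + l) + 1 by omega),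
      h.dist_eq hT (show 3 * j' ≤ 3 * (k + l) + 1 by omega)] at h1 h2
    omega
  refine ⟨fun i hi => h.adj _ (by omega), fun i hi j hj hij => ?_, hk, ?_, ?_, ?_, ?_, ?_, ?_⟩
  · have := h.inj _ (by omega) _ (by omega) hij
    omega
  · have := h.degree_end
    rwa [show 3 * (k + l) + 1 = 3 * k + (3 * l + 1) by ring] at this
  · rw [Finset.card_union_of_disjoint (h.disjoint_first.mono_left hpre').symm,
      Finset.card_image_of_injOn, Finset.card_range, ← h.card_add]
    · ring
    · intro i hi j hj hij
      simp only [Finset.coe_range, Set.mem_Iio] at hi hj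
      have := h.inj _ (by omega) _ (by omega) hij
      omega
  · exact h.first.subset (Finset.union_subset ((hstrand 0).trans Finset.subset_union_left)
      fun x hx => hfirst hx)
  · refine isPacking_of_forall ?_ ?_
    · intro x hx
      rcases Finset.mem_union.1 hx with hx | hx
      · exact h.second.minimal x (Finset.mem_union_left _ (hstrand 1 hx))
      · exact h.first.minimal x (hfirst hx)
    · have hcross : ∀ x ∈ strand l (fun i => p (3 * k + i)) 1,
          ∀ y ∈ Y ∪ (Finset.range k).image (fun j => p (3 * j)), ∀ w, w ∈ closedNbhd T x →
          w ∈ closedNbhd T y → x = y := by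
        intro x hx y hy w hwx hwy
        rcases Finset.mem_union.1 hy with hy | hy
        · exact h.second.eq_of_mem (Finset.mem_union_left _ (hstrand 1 hx))
            (Finset.mem_union_right _ hy) hwx hwy
        · exact absurd hwy (hsep x hx y hy w hwx)
      intro x hx y hy w hwx hwy
      rcases Finset.mem_union.1 hx with hx | hx <;> rcases Finset.mem_union.1 hy with hy | hy
      · exact h.second.eq_of_mem (Finset.mem_union_left _ (hstrand 1 hx))
          (Finset.mem_union_left _ (hstrand 1 hy)) hwx hwy
      · exact hcross x hx y hy w hwx hwy
      · exact (hcross y hy x hx w hwy hwx).symm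
      · exact h.first.eq_of_mem (hfirst hx) (hfirst hy) hwx hwy
  · exact Finset.disjoint_union_right.2
      ⟨h.disjoint_first.mono_left (hstrand 0), hdisj 0 (by omega)⟩
  · exact Finset.disjoint_union_right.2
      ⟨h.disjoint_second.mono_left (hstrand 1), hdisj 1 le_rfl⟩

/-- As long as some inner `p_{3j+3}` has degree at least three, the path can be restarted there,
which makes it shorter. -/
lemma exists_degree_lt (hT : T.IsTree) (h : AlternatingPath T m p Y) :
    ∃ m p Y, AlternatingPath T m p Y ∧ ∀ j < m, T.degree (p (3 * j + 3)) < 3 := by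
  induction m using Nat.strong_induction_on generalizing p Y with
  | _ m ih =>
    by_cases hdeg : ∀ j < m, T.degree (p (3 * j + 3)) < 3
    · exact ⟨m, p, Y, h, hdeg⟩
    · push Not at hdeg
      obtain ⟨j, hj, hdeg⟩ := hdeg
      obtain ⟨l, rfl⟩ := Nat.exists_eq_add_of_le (Nat.succ_le_of_lt hj)
      exact ih l (by omega) (h.suffix hT hdeg)

lemma eq_of_mem_closedNbhd (h : AlternatingPath T m p Y) {j : ℕ} (hj : j < m)
    (hdeg : T.degree (p (3 * j + 3)) < 3) {v : V} (hv : v ∈ closedNbhd T (p (3 * j + 3))) :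
    v = p (3 * j + 2) ∨ v = p (3 * j + 3) ∨ v = p (3 * j + 4) := by
  have hsub : {p (3 * j + 2), p (3 * j + 4)} ⊆ T.neighborFinset (p (3 * j + 3)) := by
    intro x hx
    rw [SimpleGraph.mem_neighborFinset]
    rcases Finset.mem_insert.1 hx with rfl | hx
    · exact (h.adj _ (by omega)).symm
    · rw [Finset.mem_singleton.1 hx]
      exact h.adj _ (by omega)
  have hne : p (3 * j + 2) ≠ p (3 * j + 4) := fun hp => by
    have := h.inj _ (by omega) _ (by omega) hp
    omega
  have heq := Finset.eq_of_subset_of_card_le hsub (by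
    rw [Finset.card_pair hne, SimpleGraph.card_neighborFinset_eq_degree]
    omega)
  rcases mem_closedNbhd.1 hv with rfl | hv
  · exact Or.inr (Or.inl rfl)
  · rw [← SimpleGraph.mem_neighborFinset, ← heq] at hv
    simp only [Finset.mem_insert, Finset.mem_singleton] at hv
    tauto

/-- For `p_1` a second common neighbor would close a triangle; `p_4, p_7, …` are too far from `p_0`;
and members of `Y` have neighborhoods disjoint from `N[p_0]` by the first packing. -/
lemma eq_of_mem_covered (h : AlternatingPath T m p Y) (hT : T.IsTree) {x : V}
    (hx : x ∈ covered T (strand m p 1 ∪ Y)) (hadj : T.Adj (p 0) x) : x = p 1 := by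
  obtain ⟨b, hb, hxb⟩ := mem_covered.1 hx
  rcases Finset.mem_union.1 hb with hb | hb
  · obtain ⟨j, hj, rfl⟩ := mem_strand.1 hb
    rcases Nat.eq_zero_or_pos j with rfl | hj0
    · rcases mem_closedNbhd.1 hxb with h1 | h1
      · exact h1
      · exact absurd h1 (not_adj_of_adj_adj hT (h.adj 0 (Nat.zero_le _)) hadj)
    · have h1 := dist_le_of_mem_closedNbhd hT (p 0) hxb
      rw [h.dist_eq hT (by omega), SimpleGraph.dist_eq_one_iff_adj.2 hadj] at h1
      omega
  · have h1 := h.first.eq_of_mem (Finset.mem_union_left _ start_mem_strand)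
      (Finset.mem_union_right _ hb) (mem_closedNbhd.2 (Or.inr hadj)) hxb
    exact absurd (h1 ▸ hb) (Finset.disjoint_left.1 h.disjoint_first start_mem_strand)

lemma start_notMem (h : AlternatingPath T m p Y) : p 0 ∉ strand m p 1 ∪ Y := by
  intro h0
  have hadj := h.adj 0 (Nat.zero_le _)
  exact hadj.ne (h.second.eq_of_mem h0 (Finset.mem_union_left _ one_mem_strand)
    (self_mem_closedNbhd _) (mem_closedNbhd.2 (Or.inr hadj.symm)))

lemma card_second (h : AlternatingPath T m p Y) :
    (strand m p 1 ∪ Y).card = matchingNumber (closedNbhdComplex T) := by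
  rw [Finset.card_union_of_disjoint h.disjoint_second, h.card_strand le_rfl, ← h.card_add,
    add_comm]

lemma exists_mem_parent_mem (h : AlternatingPath T m p Y) (hT : T.IsTree) {Z : Finset V}
    (hZ : IsPacking T Z) (hcard : Z.card = matchingNumber (closedNbhdComplex T))
    (hZW : ∀ x ∈ covered T Z, x ∈ covered T (strand m p 1 ∪ Y) ∨ T.Adj (p 0) x)
    {b : V} (hb : b ∈ strand m p 1 ∪ Y) :
    ∃ z ∈ Z, parent T (p 0) b ∈ closedNbhd T z ∧
      (T.Adj (p 0) z → z ≠ p 1 → parent T (p 0) b ≠ p 0) :=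
  exists_mem_parent_mem_closedNbhd hT h.second h.start_notMem
    (Finset.mem_union_left _ one_mem_strand) (h.adj 0 (Nat.zero_le _))
    (h.first.minimal _ (Finset.mem_union_left _ start_mem_strand))
    (fun _ hx hadj => h.eq_of_mem_covered hT hx hadj) hZ (hcard.trans h.card_second.symm) hZW hb

/-- The parent `p_0` of `p_1` is covered by some `z` in `Z`, and the last clause of the transversal
lemma rules out that `z` is a neighbor of `p_0` other than `p_1`. -/
lemma zero_mem_or_one_mem (h : AlternatingPath T m p Y) (hT : T.IsTree) {Z : Finset V}
    (hZ : IsPacking T Z) (hcard : Z.card = matchingNumber (closedNbhdComplex T))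
    (hZW : ∀ x ∈ covered T Z, x ∈ covered T (strand m p 1 ∪ Y) ∨ T.Adj (p 0) x) :
    p 1 ∈ Z ∨ p 0 ∈ Z := by
  obtain ⟨z, hz, hpz, hne⟩ :=
    h.exists_mem_parent_mem hT hZ hcard hZW (Finset.mem_union_left _ one_mem_strand)
  have hpar : parent T (p 0) (p 1) = p 0 := h.parent_succ hT (Nat.zero_le _)
  rw [hpar] at hpz hne
  rcases mem_closedNbhd.1 hpz with h1 | h1
  · exact Or.inr (h1 ▸ hz)
  · by_contra hcon
    push Not at hcon
    exact hne h1.symm (fun h2 => hcon.1 (h2 ▸ hz)) rfl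

/-- Membership propagates along the path. The parent `p_{3j+3}` of `p_{3j+4}` must be covered, and
having degree two it can only be covered by `p_{3j+2}`, `p_{3j+3}` or `p_{3j+4}`; the first two
conflict with `p_{3j+1}` at `p_{3j+2}`. -/
lemma strand_subset (h : AlternatingPath T m p Y) (hT : T.IsTree)
    (hdeg : ∀ j < m, T.degree (p (3 * j + 3)) < 3) {Z : Finset V}
    (hZ : IsPacking T Z) (hcard : Z.card = matchingNumber (closedNbhdComplex T))
    (hZW : ∀ x ∈ covered T Z, x ∈ covered T (strand m p 1 ∪ Y) ∨ T.Adj (p 0) x)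
    (h1 : p 1 ∈ Z) : strand m p 1 ⊆ Z := by
  suffices hmem : ∀ j ≤ m, p (3 * j + 1) ∈ Z by
    intro x hx
    obtain ⟨j, hj, rfl⟩ := mem_strand.1 hx
    exact hmem j hj
  intro j
  induction j with
  | zero => exact fun _ => h1
  | succ j ih =>
    intro hj
    have hjZ := ih (by omega)
    obtain ⟨z, hz, hpz, -⟩ := h.exists_mem_parent_mem hT hZ hcard hZW
      (Finset.mem_union_left _ (mem_strand.2 ⟨j + 1, hj, rfl⟩))
    rw [h.parent_succ hT (by omega)] at hpz
    have hmid : p (3 * j + 2) ∈ closedNbhd T (p (3 * j + 1)) :=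
      mem_closedNbhd.2 (Or.inr (h.adj _ (by omega)))
    have hcontra : ∀ i ≤ 3 * m + 1, 3 * j + 1 < i → z = p i →
        p (3 * j + 2) ∈ closedNbhd T z → False := by
      intro i hi hij hzi hmem
      have := h.inj _ (by omega) _ hi ((hZ.eq_of_mem hjZ hz hmid hmem).trans hzi)
      omega
    rcases h.eq_of_mem_closedNbhd (by omega) (hdeg j (by omega)) (mem_closedNbhd_comm.1 hpz)
      with h2 | h2 | h2
    · exact (hcontra _ (by omega) (by omega) h2 (h2 ▸ self_mem_closedNbhd _)).elim
    · exact (hcontra _ (by omega) (by omega) h2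
        (h2 ▸ mem_closedNbhd.2 (Or.inr (h.adj _ (by omega)).symm))).elim
    · exact (show p (3 * (j + 1) + 1) = z from h2.symm) ▸ hz

lemma mem_closedNbhd_strand_zero (h : AlternatingPath T m p Y)
    (hdeg : ∀ j < m, T.degree (p (3 * j + 3)) < 3) {u v : V} (hu : u ∈ strand m p 0)
    (hv : v ∈ closedNbhd T u) :
    (T.Adj (p 0) v ∧ v ≠ p 1) ∨ ∃ i ≤ 3 * m + 1, v = p i := by
  obtain ⟨j, hj, rfl⟩ := mem_strand.1 hu
  rcases j with _ | j
  · rcases mem_closedNbhd.1 hv with h1 | h1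
    · exact Or.inr ⟨0, by omega, h1⟩
    · by_cases h2 : v = p 1
      · exact Or.inr ⟨1, by omega, h2⟩
      · exact Or.inl ⟨h1, h2⟩
  · rcases h.eq_of_mem_closedNbhd (by omega) (hdeg j (by omega)) hv with h1 | h1 | h1
    · exact Or.inr ⟨_, by omega, h1⟩
    · exact Or.inr ⟨_, by omega, h1⟩
    · exact Or.inr ⟨_, by omega, h1⟩

lemma exists_strand_one (h : AlternatingPath T m p Y) {i : ℕ} (hi : i ≤ 3 * m + 1) :
    ∃ b ∈ strand m p 1, p i ∈ closedNbhd T b := by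
  obtain ⟨q, rfl | rfl | rfl⟩ : ∃ q, i = 3 * q + 1 ∨ i = 3 * q ∨ i = 3 * q + 2 :=
    ⟨i / 3, by omega⟩
  · exact ⟨_, mem_strand.2 ⟨q, by omega, rfl⟩, self_mem_closedNbhd _⟩
  · exact ⟨_, mem_strand.2 ⟨q, by omega, rfl⟩,
      mem_closedNbhd.2 (Or.inr (h.adj _ (by omega)).symm)⟩
  · exact ⟨_, mem_strand.2 ⟨q, by omega, rfl⟩, mem_closedNbhd.2 (Or.inr (h.adj _ (by omega)))⟩

/-- Shifting a maximum packing along the path: at the far end the neighbors of the last vertex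
are given up, at the near end the neighbors of the first vertex are gained. -/
lemma exists_shift (h : AlternatingPath T m p Y) (hT : T.IsTree)
    (hdeg : ∀ j < m, T.degree (p (3 * j + 3)) < 3) {Z : Finset V}
    (hZ : IsPacking T Z) (hsub : strand m p 1 ⊆ Z)
    (hD : ∀ x ∈ covered T Z, T.Adj (p 0) x → x = p 1) :
    ∃ A, IsPacking T A ∧ A.card = Z.card ∧ p 0 ∈ A ∧
      covered T A ⊆ covered T Z ∪ (T.neighborFinset (p 0)).erase (p 1) ∧
      (covered T A).card + 2 ≤
        (covered T Z).card + ((T.neighborFinset (p 0)).erase (p 1)).card := by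
  set D := (T.neighborFinset (p 0)).erase (p 1) with hDdef
  set E := (T.neighborFinset (p (3 * m + 1))).erase (p (3 * m)) with hEdef
  have hmemD : ∀ {x}, x ∈ D ↔ T.Adj (p 0) x ∧ x ≠ p 1 := by
    intro x
    rw [hDdef, Finset.mem_erase, SimpleGraph.mem_neighborFinset, and_comm]
  have hend : p (3 * m + 1) ∈ strand m p 1 := mem_strand.2 ⟨m, le_rfl, rfl⟩
  have hEN : ∀ {x}, x ∈ E → x ∈ closedNbhd T (p (3 * m + 1)) := by
    intro x hx
    rw [hEdef, Finset.mem_erase, SimpleGraph.mem_neighborFinset] at hx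
    exact mem_closedNbhd.2 (Or.inr hx.2)
  have hEcard : 2 ≤ E.card := by
    have h1 := Finset.pred_card_le_card_erase (s := T.neighborFinset (p (3 * m + 1)))
      (a := p (3 * m))
    rw [SimpleGraph.card_neighborFinset_eq_degree, ← hEdef] at h1
    have := h.degree_end
    omega
  have hEZ : E ⊆ covered T Z := fun x hx => mem_covered.2 ⟨_, hsub hend, hEN hx⟩
  -- `E` consists of children of the last vertex, whereas the parent of a path vertex other than the
  -- root is its predecessor.
  have hpathE : ∀ i ≤ 3 * m + 1, p i ∉ E := by
    intro i hi hE
    rw [hEdef, Finset.mem_erase, SimpleGraph.mem_neighborFinset] at hE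
    rcases parent_eq_or_parent_eq hT (p 0) hE.2 with h1 | h1
    · rw [h.parent_succ hT le_rfl] at h1
      exact hE.1 h1.symm
    · rcases i with _ | i
      · rw [parent_self] at h1
        have := h.inj _ (by omega) _ (by omega) h1
        omega
      · rw [h.parent_succ hT (by omega)] at h1
        have := h.inj _ (by omega) _ (by omega) h1
        omega
  have hcross : ∀ x ∈ strand m p 0, ∀ y ∈ Z \ strand m p 1, ∀ w, w ∈ closedNbhd T x →
      w ∉ closedNbhd T y := by
    intro x hx y hy w hwx hwy
    rw [Finset.mem_sdiff] at hy
    rcases h.mem_closedNbhd_strand_zero hdeg hx hwx with ⟨h1, h2⟩ | ⟨i, hi, rfl⟩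
    · exact h2 (hD w (mem_covered.2 ⟨y, hy.1, hwy⟩) h1)
    · obtain ⟨b, hb, hib⟩ := h.exists_strand_one hi
      exact hy.2 (hZ.eq_of_mem hy.1 (hsub hb) hwy hib ▸ hb)
  -- Replacing one strand by the other uncovers all of `E`, and `D` is all that can be newly
  -- covered.
  have hcov : covered T (strand m p 0 ∪ (Z \ strand m p 1)) ⊆ (covered T Z \ E) ∪ D := by
    intro x hx
    obtain ⟨y, hy, hxy⟩ := mem_covered.1 hx
    rcases Finset.mem_union.1 hy with hy | hy
    · rcases h.mem_closedNbhd_strand_zero hdeg hy hxy with h1 | ⟨i, hi, rfl⟩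
      · exact Finset.mem_union_right _ (hmemD.2 h1)
      · obtain ⟨b, hb, hib⟩ := h.exists_strand_one hi
        exact Finset.mem_union_left _ (Finset.mem_sdiff.2
          ⟨mem_covered.2 ⟨b, hsub hb, hib⟩, hpathE i hi⟩)
    · rw [Finset.mem_sdiff] at hy
      refine Finset.mem_union_left _ (Finset.mem_sdiff.2 ⟨mem_covered.2 ⟨y, hy.1, hxy⟩, ?_⟩)
      intro hxE
      exact hy.2 (hZ.eq_of_mem hy.1 (hsub hend) hxy (hEN hxE) ▸ hend)
  refine ⟨strand m p 0 ∪ (Z \ strand m p 1), isPacking_of_forall ?_ ?_, ?_,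
    Finset.mem_union_left _ start_mem_strand,
    hcov.trans (Finset.union_subset_union Finset.sdiff_subset Finset.Subset.rfl), ?_⟩
  · intro x hx
    rcases Finset.mem_union.1 hx with hx | hx
    · exact h.first.minimal x (Finset.mem_union_left _ hx)
    · exact hZ.minimal x (Finset.mem_sdiff.1 hx).1
  · intro x hx y hy w hwx hwy
    rcases Finset.mem_union.1 hx with hx | hx <;> rcases Finset.mem_union.1 hy with hy | hy
    · exact h.first.eq_of_mem (Finset.mem_union_left _ hx) (Finset.mem_union_left _ hy) hwx hwy
    · exact absurd hwy (hcross x hx y hy w hwx)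
    · exact absurd hwx (hcross y hy x hx w hwy)
    · exact hZ.eq_of_mem (Finset.mem_sdiff.1 hx).1 (Finset.mem_sdiff.1 hy).1 hwx hwy
  · rw [Finset.card_union_of_disjoint, Finset.card_sdiff_of_subset hsub,
      h.card_strand (Nat.zero_le _), h.card_strand le_rfl]
    · have := Finset.card_le_card hsub
      rw [h.card_strand le_rfl] at this
      omega
    · exact Finset.disjoint_left.2 fun x hx hx' =>
        hcross x hx x hx' x (self_mem_closedNbhd x) (self_mem_closedNbhd x)
  · have h1 := (Finset.card_le_card hcov).trans (Finset.card_union_le _ _)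
    rw [Finset.card_sdiff_of_subset hEZ] at h1
    have h2 := Finset.card_le_card hEZ
    omega

/-- The main combinatorial argument: the maximum packings inside the union of the two given ones
fall into two families, those containing `p_1` and those containing `p_0`. -/
theorem exists_not_isLinearlyRelated (K : Type*) [Field K] (h : AlternatingPath T m p Y)
    (hT : T.IsTree) (hdeg : ∀ j < m, T.degree (p (3 * j + 3)) < 3) :
    ∃ a, ¬ IsComponentwiseLinear (squarefreePower (closedNbhdIdeal K T)
        (matchingNumber (closedNbhdComplex T))) ∧
      ¬ IsLinearlyRelated a (degreeComponentIdeal (squarefreePower (closedNbhdIdeal K T)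
        (matchingNumber (closedNbhdComplex T))) a) := by
  classical
  set ν := matchingNumber (closedNbhdComplex T) with hν
  set D := (T.neighborFinset (p 0)).erase (p 1) with hDdef
  set W := covered T (strand m p 1 ∪ Y) ∪ D with hWdef
  have hadj := h.adj 0 (Nat.zero_le _)
  have hmemD : ∀ {x}, x ∈ D ↔ T.Adj (p 0) x ∧ x ≠ p 1 := by
    intro x
    rw [hDdef, Finset.mem_erase, SimpleGraph.mem_neighborFinset, and_comm]
  have hDcard : 2 ≤ D.card := by
    have h1 := Finset.pred_card_le_card_erase (s := T.neighborFinset (p 0)) (a := p 1)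
    rw [SimpleGraph.card_neighborFinset_eq_degree, ← hDdef] at h1
    have := h.degree_start
    omega
  have hW : ∀ {Z}, covered T Z ⊆ W →
      ∀ x ∈ covered T Z, x ∈ covered T (strand m p 1 ∪ Y) ∨ T.Adj (p 0) x := by
    intro Z hZ x hx
    exact (Finset.mem_union.1 (hZ hx)).imp_right fun h1 => (hmemD.1 h1).1
  -- The conditions are those that the exchanged packing `B` below will satisfy, so that `Z` bounds
  -- its cover from below.
  obtain ⟨Z, hZ, hmin⟩ := Finset.exists_min_image
    (Finset.univ.filter fun Z => IsPacking T Z ∧ Z.card = ν ∧ covered T Z ⊆ W ∧ p 1 ∈ Z ∧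
      ∀ x ∈ covered T Z, T.Adj (p 0) x → x = p 1) (fun Z => (covered T Z).card)
    ⟨strand m p 1 ∪ Y, Finset.mem_filter.2 ⟨Finset.mem_univ _, h.second, h.card_second,
      Finset.subset_union_left, Finset.mem_union_left _ one_mem_strand,
      fun x hx => h.eq_of_mem_covered hT hx⟩⟩
  obtain ⟨-, hZ, hZν, hZW, hZ1, hZD⟩ := Finset.mem_filter.1 hZ
  obtain ⟨A, hA, hAZ, hA0, hAW, hAcard⟩ := h.exists_shift hT hdeg hZ
    (h.strand_subset hT hdeg hZ hZν (hW hZW) hZ1) hZD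
  rw [← hDdef] at hAW hAcard
  -- As `D` has at least two elements, the subtraction is not truncated and `Z` covers at most this
  -- many vertices.
  refine ⟨(covered T Z).card + D.card - 2, not_isLinearlyRelated_of_two_families (W := W)
    (S := fun P => p 1 ∈ P) (S' := fun P => p 0 ∈ P) ?_ ?_ ?_ ?_⟩
  · exact fun P hP hPν hPW => h.zero_mem_or_one_mem hT hP hPν (hW hPW)
  · intro P Q hP hPν hPW hQ hQν hQW hP1 hQ0
    obtain ⟨B, C, hB, hC, hcard, hBPQ, hCPQ, hB1, hBD, hC0, hC1⟩ :=
      exists_exchange hT hadj hP hQ hP1 hQ0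
    have hcov : ∀ {X}, X ⊆ P ∪ Q → covered T X ⊆ covered T P ∪ covered T Q := by
      intro X hX x hx
      obtain ⟨y, hy, hxy⟩ := mem_covered.1 hx
      rcases Finset.mem_union.1 (hX hy) with hy | hy
      · exact Finset.mem_union_left _ (mem_covered.2 ⟨y, hy, hxy⟩)
      · exact Finset.mem_union_right _ (mem_covered.2 ⟨y, hy, hxy⟩)
    -- A maximum packing inside `W` would contain `p_0` or `p_1`.
    have hCν : C.card ≠ ν := fun hCν => by
      rcases h.zero_mem_or_one_mem hT hC hCν
        (hW ((hcov hCPQ).trans (Finset.union_subset hPW hQW))) with h1 | h1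
      · exact hC1 h1
      · exact hC0 h1
    have hBν : B.card = ν := by
      have h1 := hB.card_le
      have h2 := hC.card_le
      omega
    have hle := hmin B (Finset.mem_filter.2 ⟨Finset.mem_univ _, hB, hBν,
      (hcov hBPQ).trans (Finset.union_subset hPW hQW), hB1, hBD⟩)
    have hdisj : Disjoint (covered T B) D := Finset.disjoint_left.2 fun x hx hxD =>
      (hmemD.1 hxD).2 (hBD x hx (hmemD.1 hxD).1)
    have hDQ : D ⊆ covered T P ∪ covered T Q := fun x hx => Finset.mem_union_right _
      (mem_covered.2 ⟨_, hQ0, mem_closedNbhd.2 (Or.inr (hmemD.1 hx).1)⟩)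
    have h1 := Finset.card_le_card (Finset.union_subset (hcov hBPQ) hDQ)
    rw [Finset.card_union_of_disjoint hdisj] at h1
    omega
  · exact ⟨Z, hZ, hZν, hZW, hZ1, by omega⟩
  · exact ⟨A, hA, hAZ.trans hZν, hAW.trans (Finset.union_subset hZW Finset.subset_union_right),
      hA0, by omega⟩

end AlternatingPath

/-- A violation of Condition (C2) yields an alternating path. -/
lemma exists_alternatingPath (hC2 : ¬ ConditionC2 T) :
    ∃ m p Y, AlternatingPath T m p Y := by
  rw [ConditionC2, not_not] at hC2
  obtain ⟨n, r, s, w, Y, hn, hw, hlen, hr, hs, ⟨k, hk, hYk, hYf, hYd⟩, ⟨hMc, hMf, hMd⟩,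
    ⟨hNc, hNf, hNd⟩⟩ := hC2
  obtain ⟨m, rfl⟩ := Nat.exists_eq_add_of_le' hn
  have hwl : w.length = 3 * m + 1 := by
    rw [SimpleGraph.Walk.length_support] at hlen
    omega
  have hcenter : ∀ F ∈ Y, ∃ u, closedNbhd T u = F := fun F hF => by
    obtain ⟨u, -, rfl⟩ := mem_facets_closedNbhdComplex.1 (hYf F hF)
    exact ⟨u, rfl⟩
  have : Nonempty V := ⟨r⟩
  choose! c hc using hcenter
  have hYc : (Y.image c).image (closedNbhd T) = Y := by
    rw [Finset.image_image]
    ext F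
    rw [Finset.mem_image]
    constructor
    · rintro ⟨G, hG, rfl⟩
      simpa [hc G hG] using hG
    · exact fun hF => ⟨F, hF, hc F hF⟩
  have hYcard : (Y.image c).card ≤ Y.card := Finset.card_image_le
  have key : ∀ i, IsKMatching (closedNbhdComplex T) (matchingNumber (closedNbhdComplex T))
      ((Finset.range (m + 1)).image (fun j => closedNbhd T (w.getVert (3 * j + i))) ∪ Y) →
      IsPacking T (strand m w.getVert i ∪ Y.image c) ∧
        Disjoint (strand m w.getVert i) (Y.image c) ∧ (Y.image c).card = Y.card := by
    rintro i ⟨hcard, hf, hd⟩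
    have himage : (strand m w.getVert i ∪ Y.image c).image (closedNbhd T) =
        (Finset.range (m + 1)).image (fun j => closedNbhd T (w.getVert (3 * j + i))) ∪ Y := by
      rw [Finset.image_union, hYc, strand, Finset.image_image]
      rfl
    rw [← himage] at hcard hf hd
    have h1 : (strand m w.getVert i).card ≤ m + 1 :=
      Finset.card_image_le.trans (by simp)
    have h2 := Finset.card_union_add_card_inter (strand m w.getVert i) (Y.image c)
    have h3 := Finset.card_image_le (s := strand m w.getVert i ∪ Y.image c)
      (f := closedNbhd T)
    -- There are at most `(m + 1) + |Y| = ν` centers and exactly `ν` facets, so no centers coincide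
    -- and no two share a neighborhood.
    have hinj : Set.InjOn (closedNbhd T) (strand m w.getVert i ∪ Y.image c : Finset V) :=
      Finset.card_image_iff.1 (by omega)
    refine ⟨⟨?_, ?_⟩, ?_, by omega⟩
    · intro u hu v
      obtain ⟨u', hu', huu'⟩ := mem_facets_closedNbhdComplex.1
        (hf _ (Finset.mem_image_of_mem _ hu))
      rw [huu']
      exact hu' v
    · intro u hu v hv huv
      exact hd (Finset.mem_image_of_mem _ hu) (Finset.mem_image_of_mem _ hv)
        fun h => huv (hinj hu hv h)
    · rw [Finset.disjoint_iff_inter_eq_empty, ← Finset.card_eq_zero]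
      omega
  -- The index `3 * j + 0` agrees definitionally with `3 * j`.
  obtain ⟨hP, hPd, hYeq⟩ := key 0 ⟨hMc, hMf, hMd⟩
  obtain ⟨hQ, hQd, -⟩ := key 1 ⟨hNc, hNf, hNd⟩
  refine ⟨m, w.getVert, Y.image c, ⟨?_, ?_, ?_, ?_, ?_, hP, hQ, hPd, hQd⟩⟩
  · exact fun i hi => w.adj_getVert_succ (by omega)
  · intro i hi j hj hij
    exact hw.getVert_injOn (by simp; omega) (by simp; omega) hij
  · rwa [SimpleGraph.Walk.getVert_zero]
  · rw [← hwl, SimpleGraph.Walk.getVert_length]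
    exact hs
  · omega

end AlternatingPaths

end NbhdIdeal

theorem theorem4p2 {K : Type*} [Field K] {V : Type*} [Fintype V] [DecidableEq V]
    (T : SimpleGraph V) [DecidableRel T.Adj] (hT : T.IsTree)
    (hC2 : ¬ NbhdIdeal.ConditionC2 T) :
    ¬ NbhdIdeal.IsComponentwiseLinear
        (NbhdIdeal.squarefreePower (NbhdIdeal.closedNbhdIdeal K T)
          (NbhdIdeal.matchingNumber (NbhdIdeal.closedNbhdComplex T))) ∧
      ∃ a : ℕ, ¬ NbhdIdeal.IsLinearlyRelated a
        (NbhdIdeal.degreeComponentIdeal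
          (NbhdIdeal.squarefreePower (NbhdIdeal.closedNbhdIdeal K T)
            (NbhdIdeal.matchingNumber (NbhdIdeal.closedNbhdComplex T))) a) := by
  obtain ⟨_, _, _, h⟩ := NbhdIdeal.exists_alternatingPath hC2
  obtain ⟨_, _, _, h, hdeg⟩ := h.exists_degree_lt hT
  obtain ⟨a, h1, h2⟩ := h.exists_not_isLinearlyRelated K hT hdeg
  exact ⟨h1, a, h2⟩
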